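/- Let $\gamma,\mathfrak a\in\mathbb R$ with $\mathfrak a\neq 0$ and $\gamma>\gamma_c':=2-\frac{\sqrt3}{\pi}\approx 1.449$. Let $\theta$ be a real measurable function with compact support such that, for some $b>0$, $1-\frac sb\le\theta(s)\le 1+\frac sb$ for all $s\ge 0$. Put $$\beta(\mathbf y)=-\frac1{\mathfrak a}+\gamma\,\frac{\theta(|\mathbf y|)-1}{|\mathbf y|},\qquad \mathbf y\in\mathbb R^3 .$$ Write $\hat\xi(\mathbf p)=(2\pi)^{-3/2}\int_{\mathbb R^3}e^{-i\mathbf p\cdot\mathbf x}\,\xi(\mathbf x)\,d\mathbf x$ (extended unitarily to $L^2(\mathbb R^3)$). For $\lambda>0$ and $\xi\in H^{1/2}(\mathbb R^3)$ let $$\Phi^\lambda[\xi]=12\pi\int_{\mathbb R^3}\sqrt{\tfrac34 |\mathbf p|^2+\lambda}\;|\hat\xi(\mathbf p)|^2\,d\mathbf p-\frac{12}{\pi}\int_{\mathbb R^6}\frac{\overline{\hat\xi(\mathbf p)}\,\hat\xi(\mathbf q)}{|\mathbf p|^2+|\mathbf q|^2+\mathbf p\cdot\mathbf q+\lambda}\,d\mathbf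 p\,d\mathbf q+\frac{6\gamma}{\pi}\int_{\mathbb R^6}\frac{\overline{\hat\xi(\mathbf p)}\,\hat\xi(\mathbf q)}{|\mathbf p-\mathbf q|^2}\,d\mathbf p\,d\mathbf q+12\pi\int_{\mathbb R^3}\beta(\mathbf y)\,|\xi(\mathbf y)|^2\,d\mathbf y ,$$ a quadratic form in $L^2(\mathbb R^3)$ with domain $H^{1/2}(\mathbb R^3)$. Then $3-\pi^2\max\{0,2-\gamma\}^2>0$, and the following hold. (i) For all $\lambda>0$ and $\xi\in H^{1/2}(\mathbb R^3)$, the four integrals converge absolutely, $\Phi^\lambda[\xi]$ is real, and $$\Phi^\lambda[\xi]\ge c(\lambda)\,\|\xi\|_{L^2(\mathbb R^3)}^2,\qquad c(\lambda)=4\sqrt3\,\pi\sqrt\lambda\,\sqrt{3-\pi^2\max\{0,2-\gamma\}^2}+12\pi\operatorname*{ess\,inf}_{\mathbb R^3}\beta .$$ (ii) For every $$\lambda>\frac{3\min\{0,\operatorname{ess\,inf}\beta\}^2}{3-\pi^2\max\{0,2-\gamma\}^2}$$ one has $c(\lambda)>0$ and the form $\Phi^\lambda$ is closed: if $u_n\in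 H^{1/2}(\mathbb R^3)$, $u_n\to\xi$ in $L^2(\mathbb R^3)$ and $\Phi^\lambda[u_n-u_m]\to0$ as $n,m\to\infty$, then $\xi\in H^{1/2}(\mathbb R^3)$ and $\Phi^\lambda[u_n-\xi]\to 0$. In particular, for all such $\lambda$ the form $\Phi^\lambda$ is closed and bounded from below by a positive constant. -/

import Mathlib

open MeasureTheory Filter Topology
open scoped FourierTransform ComplexConjugate

noncomputable section

namespace ThreeBoson

/-- The Euclidean space `ℝ³`. -/
abbrev R3 : Type := EuclideanSpace ℝ (Fin 3)

/-- The complex Hilbert space `L²(ℝ³)`. -/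
abbrev L2R3 : Type := Lp ℂ 2 (volume : Measure R3)

/-- The unitary Fourier transform in the angular-frequency convention,
`ξ̂(p) = (2π)^(-3/2) ∫ e^(-i p·x) ξ(x) dx`, extended to `L²(ℝ³)`. Mathlib's `𝓕` has the kernel
`e^(-2πi p·x)`, whence the rescaling. -/
def hat (ξ : L2R3) (p : R3) : ℂ :=
  (((2 * Real.pi) ^ (-(3 / 2) : ℝ) : ℝ) : ℂ) * (𝓕 ξ : L2R3) ((2 * Real.pi)⁻¹ • p)

/-- The Sobolev space `H^{1/2}(ℝ³)`, as a set of elements of `L²(ℝ³)`. -/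
def HHalf : Set L2R3 :=
  {ξ | TemperedDistribution.MemSobolev (1 / 2 : ℝ) 2 (Lp.toTemperedDistribution ξ)}

/-- The potential `β(y) = -1/𝔞 + γ (θ(|y|) - 1)/|y|`. -/
def beta (γ 𝔞 : ℝ) (θ : ℝ → ℝ) (y : R3) : ℝ :=
  -1 / 𝔞 + γ * ((θ ‖y‖ - 1) / ‖y‖)

def diagIntegrand (lam : ℝ) (ξ : L2R3) (p : R3) : ℝ :=
  Real.sqrt (3 / 4 * ‖p‖ ^ 2 + lam) * ‖hat ξ p‖ ^ 2

def offIntegrand (lam : ℝ) (ξ : L2R3) (z : R3 × R3) : ℂ :=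
  conj (hat ξ z.1) * hat ξ z.2 /
    ((‖z.1‖ ^ 2 + ‖z.2‖ ^ 2 + inner ℝ z.1 z.2 + lam : ℝ) : ℂ)

def regIntegrand (ξ : L2R3) (z : R3 × R3) : ℂ :=
  conj (hat ξ z.1) * hat ξ z.2 / ((‖z.1 - z.2‖ ^ 2 : ℝ) : ℂ)

def zeroIntegrand (γ 𝔞 : ℝ) (θ : ℝ → ℝ) (ξ : L2R3) (y : R3) : ℝ :=
  beta γ 𝔞 θ y * ‖ξ y‖ ^ 2

def PhiDiag (lam : ℝ) (ξ : L2R3) : ℝ :=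
  12 * Real.pi * ∫ p, diagIntegrand lam ξ p

def PhiOff (lam : ℝ) (ξ : L2R3) : ℂ :=
  -((12 / Real.pi : ℝ) : ℂ) * ∫ z, offIntegrand lam ξ z

def PhiReg (γ : ℝ) (ξ : L2R3) : ℂ :=
  ((6 * γ / Real.pi : ℝ) : ℂ) * ∫ z, regIntegrand ξ z

def PhiZero (γ 𝔞 : ℝ) (θ : ℝ → ℝ) (ξ : L2R3) : ℝ :=
  12 * Real.pi * ∫ y, zeroIntegrand γ 𝔞 θ ξ y

/-- The form `Φ^λ`, with domain `HHalf`. -/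
def Phi (γ 𝔞 : ℝ) (θ : ℝ → ℝ) (lam : ℝ) (ξ : L2R3) : ℂ :=
  (PhiDiag lam ξ : ℂ) + PhiOff lam ξ + PhiReg γ ξ + (PhiZero γ 𝔞 θ ξ : ℂ)

/-- All four integrals that make up `Φ^λ[ξ]` converge absolutely. -/
def PhiWellDefined (γ 𝔞 : ℝ) (θ : ℝ → ℝ) (lam : ℝ) (ξ : L2R3) : Prop :=
  Integrable (diagIntegrand lam ξ) ∧ Integrable (offIntegrand lam ξ) ∧
    Integrable (regIntegrand ξ) ∧ Integrable (zeroIntegrand γ 𝔞 θ ξ)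

/-- Closedness of a quadratic form `q` with domain `D` in `L²(ℝ³)`: if `uₙ ∈ D`, `uₙ → ξ` in
`L²(ℝ³)` and `q[uₙ - uₘ] → 0`, then `ξ ∈ D` and `q[uₙ - ξ] → 0`. -/
def IsClosedForm (D : Set L2R3) (q : L2R3 → ℂ) : Prop :=
  ∀ (u : ℕ → L2R3) (ξ : L2R3), (∀ n, u n ∈ D) → Tendsto u atTop (𝓝 ξ) →
    Tendsto (fun k : ℕ × ℕ => q (u k.1 - u k.2)) atTop (𝓝 0) →
    ξ ∈ D ∧ Tendsto (fun n => q (u n - ξ)) atTop (𝓝 0)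

/-- The threshold `γ'_c = 2 - √3/π`. -/
def gammaC' : ℝ := 2 - Real.sqrt 3 / Real.pi

/-- The number `3 - π² max{0, 2 - γ}²`. -/
def gap (γ : ℝ) : ℝ := 3 - Real.pi ^ 2 * (max 0 (2 - γ)) ^ 2

/-- The constant `c(λ) = 4√3 π √λ √(3 - π² max{0, 2 - γ}²) + 12 π ess inf β`. -/
def coercivityConst (γ 𝔞 : ℝ) (θ : ℝ → ℝ) (lam : ℝ) : ℝ :=
  4 * Real.sqrt 3 * Real.pi * Real.sqrt lam * Real.sqrt (gap γ)
    + 12 * Real.pi * essInf (beta γ 𝔞 θ) volume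

end ThreeBoson

end

noncomputable section

namespace ThreeBoson

open scoped ENNReal

/-! Write K for `kinetic ξ`, the integral of |p||ξ̂|², and let off and reg be the double integrals
with kernels 1/(p²+q²+p·q+λ) and 1/|p-q|². The two non-local terms are controlled by two facts.

Positivity: 0 ≤ reg and off ≤ reg. By the Laplace transform, the difference of the kernels is a
superposition over t > 0 of e^{-tp²} e^{-tq²} (e^{2t p·q} - e^{-tλ} e^{-t p·q}). The power series in
p·q of the bracket has coefficients tⁿ(2ⁿ - e^{-tλ}(-1)ⁿ)/n! ≥ 0, and powers of p·q are positive
kernels. This is `isPosKernel_exp_sub`, integrated in `re_off_le_reg`.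

Boundedness: reg ≤ π³ K. This is a Schur test whose constant comes from ∫ dq/(|p-q|²|q|²) = π³/|p|
(`lintegral_schur`, `lintegral_inv_normSq_sub_mul_normSq`).

Hence -(12/π) off + (6γ/π) reg ≥ -(6/π)(2-γ) reg ≥ -6π² max{0,2-γ} K (`le_phi_re`). What remains is
multiplication by the symbol 12π√(3r²/4+λ) - 6π² max{0,2-γ} r at r = |p|, plus the bounded potential
β. Minimizing the symbol over r gives c(λ) (`symbol_lower_bound`). For γ above the threshold the
symbol also dominates a positive multiple of r (`symbol_kinetic_bound`), so Φ controls K up to a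
multiple of ‖ξ‖². Conversely K and ‖ξ‖² control Φ (`norm_phi_le`). Closedness then follows from
Fatou's lemma for K. -/

/-! ### The rescaled Fourier transform and H^{1/2} as a weighted L² condition -/

theorem eLpNorm_two_sq {α E : Type*} [MeasurableSpace α] [NormedAddCommGroup E] (μ : Measure α)
    (f : α → E) : eLpNorm f 2 μ ^ 2 = ∫⁻ x, ‖f x‖ₑ ^ 2 ∂μ := by
  have h := eLpNorm_nnreal_pow_eq_lintegral (f := f) (μ := μ) (p := 2) two_ne_zero
  simp only [NNReal.coe_ofNat, ENNReal.rpow_ofNat, ENNReal.coe_ofNat] at h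
  exact h

theorem eLpNorm_two_lt_top_iff {α E : Type*} [MeasurableSpace α] [NormedAddCommGroup E]
    (μ : Measure α) (f : α → E) : eLpNorm f 2 μ < ∞ ↔ ∫⁻ x, ‖f x‖ₑ ^ 2 ∂μ < ∞ := by
  rw [← eLpNorm_two_sq, ENNReal.pow_lt_top_iff]
  simp

theorem lintegral_comp_smul_R3 (F : R3 → ℝ≥0∞) {a : ℝ} (ha : 0 < a) :
    ∫⁻ p, F (a • p) = ENNReal.ofReal ((a ^ 3)⁻¹) * ∫⁻ p, F p := by
  have h := lintegral_map_equiv (μ := (volume : Measure R3)) F (MeasurableEquiv.smul₀ a ha.ne')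
  have h2 : Measure.map (⇑(MeasurableEquiv.smul₀ (α := R3) a ha.ne')) volume
      = ENNReal.ofReal |(a ^ 3)⁻¹| • (volume : Measure R3) := by
    have := Measure.map_addHaar_smul (volume : Measure R3) ha.ne'
    simpa using this
  rw [h2, lintegral_smul_measure, abs_of_pos (by positivity)] at h
  simpa using h.symm

theorem quasiMeasurePreserving_smul_inv_two_pi :
    Measure.QuasiMeasurePreserving (fun p : R3 => (2 * Real.pi)⁻¹ • p) volume volume :=
  Measure.quasiMeasurePreserving_smul _ (by positivity)

theorem aestronglyMeasurable_hat (ξ : L2R3) : AEStronglyMeasurable (hat ξ) volume := by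
  refine AEStronglyMeasurable.const_mul ?_ _
  exact (Lp.aestronglyMeasurable (𝓕 ξ : L2R3)).comp_quasiMeasurePreserving
    quasiMeasurePreserving_smul_inv_two_pi

theorem hat_sub_ae (ξ η : L2R3) : hat (ξ - η) =ᵐ[volume] fun p => hat ξ p - hat η p := by
  have h1 : (𝓕 (ξ - η) : L2R3) = (𝓕 ξ : L2R3) - (𝓕 η : L2R3) :=
    (Lp.fourierTransformₗᵢ R3 ℂ).map_sub ξ η
  have h2 := Lp.coeFn_sub (𝓕 ξ : L2R3) (𝓕 η : L2R3)
  have h3 := quasiMeasurePreserving_smul_inv_two_pi.ae h2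
  filter_upwards [h3] with p hp
  simp only [hat, h1, hp, Pi.sub_apply]
  ring

theorem enorm_hat_sq (ξ : L2R3) (p : R3) :
    ‖hat ξ p‖ₑ ^ 2 = ENNReal.ofReal (((2 * Real.pi) ^ 3)⁻¹) *
      ‖(𝓕 ξ : L2R3) ((2 * Real.pi)⁻¹ • p)‖ₑ ^ 2 := by
  have hpi : 0 < 2 * Real.pi := by positivity
  rw [hat, enorm_mul, mul_pow]
  congr 1
  rw [← ofReal_norm, Complex.norm_real, Real.norm_of_nonneg (by positivity),
    ← ENNReal.ofReal_pow (by positivity), ← Real.rpow_natCast, ← Real.rpow_mul hpi.le]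
  congr 1
  rw [← Real.rpow_natCast, ← Real.rpow_neg hpi.le]
  norm_num

/-- The squared prefactor (2π)⁻³ cancels the Jacobian of p = 2πx. This transfers Plancherel and the
Sobolev condition from `𝓕` to `hat`. -/
theorem lintegral_mul_enorm_hat_sq (ξ : L2R3) (w : R3 → ℝ≥0∞) :
    ∫⁻ p, w p * ‖hat ξ p‖ₑ ^ 2 = ∫⁻ x, w ((2 * Real.pi) • x) * ‖(𝓕 ξ : L2R3) x‖ₑ ^ 2 := by
  have hpi : 0 < 2 * Real.pi := by positivity
  have h := lintegral_comp_smul_R3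
    (fun x => w ((2 * Real.pi) • x) * ‖(𝓕 ξ : L2R3) x‖ₑ ^ 2) (inv_pos.mpr hpi)
  have h1 : ∀ p, w p * ‖hat ξ p‖ₑ ^ 2 = ENNReal.ofReal (((2 * Real.pi) ^ 3)⁻¹) *
      (w ((2 * Real.pi) • (2 * Real.pi)⁻¹ • p) * ‖(𝓕 ξ : L2R3) ((2 * Real.pi)⁻¹ • p)‖ₑ ^ 2) := by
    intro p
    rw [enorm_hat_sq, smul_inv_smul₀ hpi.ne']
    ring
  simp_rw [h1]
  rw [lintegral_const_mul' _ _ ENNReal.ofReal_ne_top, h, ← mul_assoc,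
    ← ENNReal.ofReal_mul (by positivity)]
  rw [inv_pow, inv_inv, inv_mul_cancel₀ (by positivity), ENNReal.ofReal_one, one_mul]

theorem lintegral_enorm_hat_sq (ξ : L2R3) : ∫⁻ p, ‖hat ξ p‖ₑ ^ 2 = ‖ξ‖ₑ ^ 2 := by
  have h := lintegral_mul_enorm_hat_sq ξ (fun _ => 1)
  simp only [one_mul] at h
  rw [h, ← eLpNorm_two_sq, ← Lp.enorm_def]
  have : ‖(𝓕 ξ : L2R3)‖ = ‖ξ‖ := Lp.norm_fourier_eq ξ
  rw [← ofReal_norm, this, ofReal_norm]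

theorem memLp_hat (ξ : L2R3) : MemLp (hat ξ) 2 volume := by
  refine ⟨aestronglyMeasurable_hat ξ, ?_⟩
  rw [eLpNorm_two_lt_top_iff, lintegral_enorm_hat_sq]
  exact ENNReal.pow_lt_top enorm_lt_top

theorem exists_smulLeftCLM_eq_iff {w : R3 → ℂ} (hw : w.HasTemperateGrowth) (g : L2R3) :
    (∃ f : L2R3, TemperedDistribution.smulLeftCLM ℂ w (Lp.toTemperedDistribution g)
      = Lp.toTemperedDistribution f) ↔ MemLp (fun x => w x * g x) 2 volume := by
  have hwc : Continuous w := hw.1.continuous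
  constructor
  · rintro ⟨f, hf⟩
    have hg : LocallyIntegrable g volume := (Lp.memLp g).locallyIntegrable one_le_two
    have hwg : LocallyIntegrable (fun x => w x * g x) volume := hg.continuous_mul hwc
    have hfl : LocallyIntegrable f volume := (Lp.memLp f).locallyIntegrable one_le_two
    have : ∀ᵐ x, w x * g x = f x := by
      -- Compactly supported real test functions, viewed as complex Schwartz functions, suffice to
      -- identify two locally integrable functions.
      refine ae_eq_of_integral_contDiff_smul_eq hwg hfl fun φ hφ hφc => ?_
      have hg₁ : HasCompactSupport (Complex.ofRealCLM ∘ φ) := hφc.comp_left rfl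
      have hg₂ : ContDiff ℝ (⊤ : ℕ∞) (Complex.ofRealCLM ∘ φ) := by
        fun_prop
      have h := DFunLike.congr_fun hf (hg₁.toSchwartzMap hg₂)
      simp only [TemperedDistribution.smulLeftCLM_apply_apply, Lp.toTemperedDistribution_apply,
        SchwartzMap.smulLeftCLM_apply_apply hw] at h
      simpa [mul_assoc, mul_comm, mul_left_comm] using h
    exact (memLp_congr_ae this).mpr (Lp.memLp f)
  · intro h
    refine ⟨h.toLp _, ?_⟩
    ext φ
    simp only [TemperedDistribution.smulLeftCLM_apply_apply, Lp.toTemperedDistribution_apply,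
        SchwartzMap.smulLeftCLM_apply_apply hw]
    refine integral_congr_ae ?_
    filter_upwards [h.coeFn_toLp] with x hx
    rw [hx]
    simp only [smul_eq_mul]
    ring

/-- The squared Bessel weight is √(1+|x|²), which lies between |x| and |x|+1; the extra 1 costs only
the finite L² norm. -/
theorem mem_HHalf_iff (ξ : L2R3) :
    ξ ∈ HHalf ↔ ∫⁻ p, ‖p‖ₑ * ‖hat ξ p‖ₑ ^ 2 < ∞ := by
  have hw : (fun x : R3 => (((1 + ‖x‖ ^ 2) ^ ((1 / 2 : ℝ) / 2) : ℝ) : ℂ)).HasTemperateGrowth := by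
    fun_prop
  have h0 : ξ ∈ HHalf ↔ MemLp (fun x : R3 => (((1 + ‖x‖ ^ 2) ^ ((1 / 2 : ℝ) / 2) : ℝ) : ℂ) *
      (𝓕 ξ : L2R3) x) 2 volume := by
    rw [← exists_smulLeftCLM_eq_iff hw, HHalf, Set.mem_ofPred_eq,
      TemperedDistribution.memSobolev_iff_exists_smulLeftCLM_fourier,
      Lp.fourier_toTemperedDistribution_eq]
  have hm : AEStronglyMeasurable (fun x : R3 => (((1 + ‖x‖ ^ 2) ^ ((1 / 2 : ℝ) / 2) : ℝ) : ℂ) *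
      (𝓕 ξ : L2R3) x) volume :=
    hw.1.continuous.aestronglyMeasurable.mul (Lp.aestronglyMeasurable _)
  have hfin : ∫⁻ x, ‖(𝓕 ξ : L2R3) x‖ₑ ^ 2 < ∞ := by
    rw [← eLpNorm_two_lt_top_iff]; exact (Lp.memLp (𝓕 ξ : L2R3)).2
  have hsq : ∀ x : R3, ‖(((1 + ‖x‖ ^ 2) ^ ((1 / 2 : ℝ) / 2) : ℝ) : ℂ) * (𝓕 ξ : L2R3) x‖ₑ ^ 2
      = ENNReal.ofReal (√(1 + ‖x‖ ^ 2)) * ‖(𝓕 ξ : L2R3) x‖ₑ ^ 2 := by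
    intro x
    rw [enorm_mul, mul_pow]
    congr 1
    rw [← ofReal_norm, Complex.norm_real, Real.norm_of_nonneg (by positivity),
      ← ENNReal.ofReal_pow (by positivity), ← Real.rpow_natCast, ← Real.rpow_mul (by positivity),
      Real.sqrt_eq_rpow]
    norm_num
  rw [h0, lintegral_mul_enorm_hat_sq]
  have h1 : MemLp (fun x : R3 => (((1 + ‖x‖ ^ 2) ^ ((1 / 2 : ℝ) / 2) : ℝ) : ℂ) *
      (𝓕 ξ : L2R3) x) 2 volume ↔
      ∫⁻ x : R3, ENNReal.ofReal (√(1 + ‖x‖ ^ 2)) * ‖(𝓕 ξ : L2R3) x‖ₑ ^ 2 < ∞ := by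
    rw [MemLp, and_iff_right hm, eLpNorm_two_lt_top_iff]
    simp_rw [hsq]
  have h2 : ∫⁻ x : R3, ‖(2 * Real.pi) • x‖ₑ * ‖(𝓕 ξ : L2R3) x‖ₑ ^ 2
      = ENNReal.ofReal (2 * Real.pi) * ∫⁻ x : R3, ENNReal.ofReal ‖x‖ * ‖(𝓕 ξ : L2R3) x‖ₑ ^ 2 := by
    rw [← lintegral_const_mul' _ _ ENNReal.ofReal_ne_top]
    refine lintegral_congr fun x => ?_
    rw [enorm_smul, Real.enorm_of_nonneg (by positivity), ofReal_norm, mul_assoc]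
  rw [h1, h2]
  constructor
  · intro h
    refine ENNReal.mul_lt_top ENNReal.ofReal_lt_top (lt_of_le_of_lt (lintegral_mono fun x => ?_) h)
    gcongr
    exact Real.le_sqrt_of_sq_le (by linarith)
  · intro h
    have h3 : ∫⁻ x : R3, ENNReal.ofReal ‖x‖ * ‖(𝓕 ξ : L2R3) x‖ₑ ^ 2 < ∞ := by
      refine ENNReal.lt_top_of_mul_ne_top_right h.ne ?_
      simp [Real.pi_pos]
    have h4 : ∫⁻ x : R3,
        (ENNReal.ofReal ‖x‖ * ‖(𝓕 ξ : L2R3) x‖ₑ ^ 2 + ‖(𝓕 ξ : L2R3) x‖ₑ ^ 2) < ∞ := by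
      rw [lintegral_add_right' _ ((Lp.aestronglyMeasurable (𝓕 ξ : L2R3)).enorm.pow_const 2)]
      exact ENNReal.add_lt_top.mpr ⟨h3, hfin⟩
    refine lt_of_le_of_lt (lintegral_mono fun x => ?_) h4
    have : ENNReal.ofReal (√(1 + ‖x‖ ^ 2)) ≤ ENNReal.ofReal ‖x‖ + 1 := by
      rw [← ENNReal.ofReal_one, ← ENNReal.ofReal_add (norm_nonneg _) zero_le_one]
      gcongr
      exact Real.sqrt_le_iff.mpr ⟨by positivity, by nlinarith [norm_nonneg x]⟩
    calc _ ≤ (ENNReal.ofReal ‖x‖ + 1) * ‖(𝓕 ξ : L2R3) x‖ₑ ^ 2 := by gcongr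
      _ = _ := by ring

theorem HHalf_sub {ξ η : L2R3} (hξ : ξ ∈ HHalf) (hη : η ∈ HHalf) : ξ - η ∈ HHalf := by
  have h := TemperedDistribution.MemSobolev.sub hξ hη
  have e : Lp.toTemperedDistribution (ξ - η)
      = Lp.toTemperedDistribution ξ - Lp.toTemperedDistribution η :=
    map_sub (Lp.toTemperedDistributionCLM ℂ volume 2) ξ η
  rw [HHalf, Set.mem_ofPred_eq, e]
  exact h

/-! ### The integral ∫ dq/(|p-q|²|q|²) = π³/|p| -/

/-- A nonnegative derivative of a function continuous up to the endpoints is automatically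
integrable, so endpoint singularities such as that of 1/√(x(1-x)) are allowed. -/
theorem lintegral_Ioc_deriv_of_nonneg {F F' : ℝ → ℝ} {a b : ℝ} (hab : a ≤ b)
    (hc : ContinuousOn F (Set.Icc a b)) (hd : ∀ x ∈ Set.Ioo a b, HasDerivAt F (F' x) x)
    (h0 : ∀ x ∈ Set.Ioc a b, 0 ≤ F' x) :
    ∫⁻ x in Set.Ioc a b, ENNReal.ofReal (F' x) = ENNReal.ofReal (F b - F a) := by
  have hi : IntegrableOn F' (Set.Ioc a b) volume :=
    intervalIntegral.integrableOn_deriv_of_nonneg hc hd fun x hx => h0 x ⟨hx.1, hx.2.le⟩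
  rw [← ofReal_integral_eq_lintegral_ofReal hi, ← intervalIntegral.integral_of_le hab,
    intervalIntegral.integral_eq_sub_of_hasDerivAt_of_le hab hc hd]
  · rwa [intervalIntegrable_iff_integrableOn_Ioc_of_le hab]
  · exact (ae_restrict_iff' measurableSet_Ioc).mpr (ae_of_all _ h0)

theorem lintegral_feynman {A B : ℝ} (hA : 0 < A) (hB : 0 < B) :
    ∫⁻ x in Set.Ioc (0 : ℝ) 1, ENNReal.ofReal (1 / (x * A + (1 - x) * B) ^ 2)
      = ENNReal.ofReal (1 / (A * B)) := by
  have hpos : ∀ x ∈ Set.Icc (0 : ℝ) 1, 0 < x * A + (1 - x) * B := by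
    intro x hx
    rcases hx.1.eq_or_lt with h | h
    · rw [← h]; simpa using hB
    · exact add_pos_of_pos_of_nonneg (by positivity) (mul_nonneg (by linarith [hx.2]) hB.le)
  rw [lintegral_Ioc_deriv_of_nonneg (F := fun x => x / (B * (x * A + (1 - x) * B))) zero_le_one]
  · congr 1
    simp [mul_comm]
  · refine ContinuousOn.div (by fun_prop) (by fun_prop) fun x hx => ?_
    exact (mul_pos hB (hpos x hx)).ne'
  · intro x hx
    have hx' := hpos x ⟨hx.1.le, hx.2.le⟩
    have h1 : HasDerivAt (fun x : ℝ => B * (x * A + (1 - x) * B)) (B * (A - B)) x := by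
      have := (((hasDerivAt_id x).mul_const A).add
        (((hasDerivAt_const x (1 : ℝ)).sub (hasDerivAt_id x)).mul_const B)).const_mul B
      exact this.congr_deriv (by ring)
    refine ((hasDerivAt_id x).div h1 (mul_pos hB hx').ne').congr_deriv ?_
    simp only [id]
    field_simp
    ring
  · intro x _
    positivity

theorem lintegral_inv_sqrt_mul_one_sub :
    ∫⁻ x in Set.Ioc (0 : ℝ) 1, ENNReal.ofReal (1 / √(x * (1 - x))) = ENNReal.ofReal Real.pi := by
  rw [lintegral_Ioc_deriv_of_nonneg (F := fun x => Real.arcsin (2 * x - 1)) zero_le_one]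
  · congr 1
    norm_num
  · exact (Real.continuous_arcsin.comp (by fun_prop)).continuousOn
  · intro x hx
    have h1 : HasDerivAt (fun x : ℝ => 2 * x - 1) 2 x := by
      simpa using ((hasDerivAt_id x).const_mul (2 : ℝ)).sub_const 1
    have h2 := (Real.hasDerivAt_arcsin (x := 2 * x - 1) (by linarith [hx.1])
      (by linarith [hx.2])).comp x h1
    refine h2.congr_deriv ?_
    have : 1 - (2 * x - 1) ^ 2 = 2 ^ 2 * (x * (1 - x)) := by ring
    rw [this, Real.sqrt_mul (by norm_num), Real.sqrt_sq (by norm_num)]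
    have h3 : 0 < √(x * (1 - x)) := Real.sqrt_pos.mpr (mul_pos hx.1 (by linarith [hx.2]))
    field_simp
  · intro x _
    positivity

/-- In polar coordinates, F is an antiderivative of r²/(r²+m²)² with F(0) = 0 and limit π/(4m); the
unit sphere contributes 3 · 4π/3 = 4π. -/
theorem lintegral_inv_normSq_add_sq {m : ℝ} (hm : 0 < m) :
    ∫⁻ q : R3, ENNReal.ofReal (1 / (‖q‖ ^ 2 + m ^ 2) ^ 2) = ENNReal.ofReal (Real.pi ^ 2 / m) := by
  set F : ℝ → ℝ := fun r => (1 / 2) * (Real.arctan (r / m) / m - r / (r ^ 2 + m ^ 2)) with hF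
  have hd : ∀ r ∈ Set.Ici (0 : ℝ), HasDerivAt F (r ^ 2 * (1 / (r ^ 2 + m ^ 2) ^ 2)) r := by
    intro r _
    have h1 : HasDerivAt (fun r : ℝ => Real.arctan (r / m)) (1 / (1 + (r / m) ^ 2) * (1 / m)) r :=
      ((hasDerivAt_id r).div_const m).arctan
    have h2 : HasDerivAt (fun r : ℝ => r ^ 2 + m ^ 2) (2 * r) r := by
      simpa using (hasDerivAt_pow 2 r).add_const (m ^ 2)
    have h3 : r ^ 2 + m ^ 2 ≠ 0 := by positivity
    refine (((h1.div_const m).sub ((hasDerivAt_id r).div h2 h3)).const_mul (1 / 2)).congr_deriv ?_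
    simp only [id]
    field_simp
    ring
  have h0 : ∀ r ∈ Set.Ioi (0 : ℝ), 0 ≤ r ^ 2 * (1 / (r ^ 2 + m ^ 2) ^ 2) := fun r _ => by positivity
  have hl : Tendsto F atTop (𝓝 (Real.pi / (4 * m))) := by
    have h1 : Tendsto (fun r : ℝ => Real.arctan (r / m)) atTop (𝓝 (Real.pi / 2)) :=
      (Real.tendsto_arctan_atTop.mono_right nhdsWithin_le_nhds).comp
        (tendsto_id.atTop_div_const hm)
    have h2 : Tendsto (fun r : ℝ => r / (r ^ 2 + m ^ 2)) atTop (𝓝 0) := by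
      refine squeeze_zero' (g := fun r : ℝ => r⁻¹) ?_ ?_ tendsto_inv_atTop_zero
      · filter_upwards [eventually_gt_atTop 0] with r hr
        positivity
      · filter_upwards [eventually_gt_atTop 0] with r hr
        rw [div_le_iff₀ (by positivity)]
        have : r⁻¹ * (r ^ 2 + m ^ 2) = r + r⁻¹ * m ^ 2 := by field_simp
        rw [this]
        have : 0 ≤ r⁻¹ * m ^ 2 := by positivity
        linarith
    convert ((h1.div_const m).sub h2).const_mul (1 / 2) using 2
    field_simp
    ring
  have hI := integral_Ioi_of_hasDerivAt_of_nonneg' hd h0 hl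
  have hIn := integrableOn_Ioi_deriv_of_nonneg' hd h0 hl
  have hint : Integrable (fun q : R3 => 1 / (‖q‖ ^ 2 + m ^ 2) ^ 2) := by
    rw [integrable_fun_norm_addHaar volume (f := fun r => 1 / (r ^ 2 + m ^ 2) ^ 2)]
    simpa using hIn
  rw [← ofReal_integral_eq_lintegral_ofReal hint (ae_of_all _ fun q => by positivity),
    integral_fun_norm_addHaar volume (fun r => 1 / (r ^ 2 + m ^ 2) ^ 2)]
  congr 1
  have hv : (volume : Measure R3).real (Metric.ball 0 1) = Real.pi * 4 / 3 := by
    rw [Measure.real, EuclideanSpace.volume_ball_fin_three]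
    rw [ENNReal.ofReal_one, one_pow, one_mul, ENNReal.toReal_ofReal (by positivity)]
  have hdim : Module.finrank ℝ R3 = 3 := by simp
  rw [hv, hdim]
  simp only [smul_eq_mul, nsmul_eq_mul, Nat.add_one_sub_one]
  rw [hI]
  simp [hF]
  field_simp

/-- Feynman's parameter x merges the two factors into one square. Completing the square centres it
at xp with mass m = √(x(1-x))|p|, so the q-integral is π²/m, and ∫ dx/√(x(1-x)) = π supplies the
last factor. -/
theorem lintegral_inv_normSq_sub_mul_normSq {p : R3} (hp : p ≠ 0) :
    ∫⁻ q : R3, ENNReal.ofReal (1 / (‖p - q‖ ^ 2 * ‖q‖ ^ 2))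
      = ENNReal.ofReal (Real.pi ^ 3 / ‖p‖) := by
  have hp' : 0 < ‖p‖ := norm_pos_iff.mpr hp
  have h1 : ∫⁻ q : R3, ENNReal.ofReal (1 / (‖p - q‖ ^ 2 * ‖q‖ ^ 2)) =
      ∫⁻ q : R3, ∫⁻ x in Set.Ioc (0 : ℝ) 1,
        ENNReal.ofReal (1 / (x * ‖p - q‖ ^ 2 + (1 - x) * ‖q‖ ^ 2) ^ 2) := by
    refine lintegral_congr_ae ?_
    filter_upwards [Measure.ae_ne volume (0 : R3), Measure.ae_ne volume p] with q hq0 hqp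
    have ha : 0 < ‖p - q‖ := norm_pos_iff.mpr (sub_ne_zero.mpr hqp.symm)
    have hb : 0 < ‖q‖ := norm_pos_iff.mpr hq0
    exact (lintegral_feynman (by positivity) (by positivity)).symm
  have hsq : ∀ (q : R3) (x : ℝ), x * ‖p - q‖ ^ 2 + (1 - x) * ‖q‖ ^ 2
      = ‖q - x • p‖ ^ 2 + x * (1 - x) * ‖p‖ ^ 2 := by
    intro q x
    rw [norm_sub_sq_real, norm_sub_sq_real, norm_smul, real_inner_smul_right, real_inner_comm q p,
      mul_pow, Real.norm_eq_abs, sq_abs]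
    ring
  rw [h1, lintegral_lintegral_swap (by fun_prop)]
  have h2 : ∀ᵐ x ∂(volume.restrict (Set.Ioc (0 : ℝ) 1)),
      ∫⁻ q : R3, ENNReal.ofReal (1 / (x * ‖p - q‖ ^ 2 + (1 - x) * ‖q‖ ^ 2) ^ 2)
        = ENNReal.ofReal (Real.pi ^ 2 / ‖p‖) * ENNReal.ofReal (1 / √(x * (1 - x))) := by
    rw [ae_restrict_iff' measurableSet_Ioc]
    filter_upwards [Measure.ae_ne volume (1 : ℝ)] with x hx1 hx
    have hx2 : 0 < x * (1 - x) := mul_pos hx.1 (sub_pos.mpr (lt_of_le_of_ne hx.2 hx1))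
    have hm : 0 < √(x * (1 - x)) * ‖p‖ := mul_pos (Real.sqrt_pos.mpr hx2) hp'
    have h3 := lintegral_inv_normSq_add_sq hm
    rw [← lintegral_sub_right_eq_self _ (x • p), mul_pow, Real.sq_sqrt hx2.le] at h3
    simp_rw [hsq]
    rw [h3, ← ENNReal.ofReal_mul (by positivity)]
    congr 1
    field_simp
  rw [lintegral_congr_ae h2, lintegral_const_mul' _ _ ENNReal.ofReal_ne_top,
    lintegral_inv_sqrt_mul_one_sub, ← ENNReal.ofReal_mul (by positivity)]
  congr 1
  ring

/-! ### The Schur test for the kernel 1/|p-q|² -/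

theorem two_mul_le_sq_add_sq (a b : ℝ≥0∞) : 2 * (a * b) ≤ a ^ 2 + b ^ 2 := by
  rcases eq_or_ne a ∞ with rfl | ha
  · simp
  rcases eq_or_ne b ∞ with rfl | hb
  · simp
  lift a to NNReal using ha
  lift b to NNReal using hb
  have := two_mul_le_add_sq a b
  rw [mul_assoc] at this
  exact_mod_cast this

/-- Split 2f(p)f(q) ≤ (f(p)|p|/|q|)² + (f(q)|q|/|p|)². The two resulting integrals agree by
symmetry, and integrating out the free variable in the first turns |p|² into π³|p|. -/
theorem lintegral_schur {f : R3 → ℝ≥0∞} (hf : AEMeasurable f volume) :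
    ∫⁻ z : R3 × R3, f z.1 * f z.2 * ENNReal.ofReal (1 / ‖z.1 - z.2‖ ^ 2)
      ≤ ENNReal.ofReal (Real.pi ^ 3) * ∫⁻ p, ‖p‖ₑ * f p ^ 2 := by
  set G : R3 × R3 → ℝ≥0∞ := fun z => f z.1 ^ 2 * ENNReal.ofReal (‖z.1‖ ^ 2) *
    ENNReal.ofReal (1 / (‖z.1 - z.2‖ ^ 2 * ‖z.2‖ ^ 2)) with hG
  have hGm : AEMeasurable G (volume.prod volume) := by
    have h1 : AEMeasurable (fun z : R3 × R3 => f z.1) (volume.prod volume) :=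
      hf.comp_quasiMeasurePreserving Measure.quasiMeasurePreserving_fst
    exact ((h1.pow_const 2).mul (by fun_prop)).mul (by fun_prop)
  have hGi : ∫⁻ z, G z = ENNReal.ofReal (Real.pi ^ 3) * ∫⁻ p, ‖p‖ₑ * f p ^ 2 := by
    rw [Measure.volume_eq_prod, lintegral_prod _ hGm,
      ← lintegral_const_mul' _ _ ENNReal.ofReal_ne_top]
    refine lintegral_congr_ae ?_
    filter_upwards [Measure.ae_ne volume (0 : R3)] with p hp
    have hp' : 0 < ‖p‖ := norm_pos_iff.mpr hp
    simp only [hG]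
    rw [lintegral_const_mul _ (by fun_prop), lintegral_inv_normSq_sub_mul_normSq hp, mul_assoc,
      ← ENNReal.ofReal_mul (by positivity), ← ofReal_norm, mul_comm, ← mul_assoc,
      ← ENNReal.ofReal_mul (by positivity)]
    congr 2
    field_simp
  have hGs : ∫⁻ z : R3 × R3, G z.swap = ∫⁻ z, G z := lintegral_prod_swap G
  have h1 : ∀ᵐ z : R3 × R3, 2 * (f z.1 * f z.2 * ENNReal.ofReal (1 / ‖z.1 - z.2‖ ^ 2))
      ≤ G z + G z.swap := by
    have ha : ∀ᵐ z : R3 × R3, z.1 ≠ 0 :=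
      Measure.quasiMeasurePreserving_fst.ae (Measure.ae_ne volume (0 : R3))
    have hb : ∀ᵐ z : R3 × R3, z.2 ≠ 0 :=
      Measure.quasiMeasurePreserving_snd.ae (Measure.ae_ne volume (0 : R3))
    filter_upwards [ha, hb] with z hz1 hz2
    have h1 : 0 < ‖z.1‖ := norm_pos_iff.mpr hz1
    have h2 : 0 < ‖z.2‖ := norm_pos_iff.mpr hz2
    have huv : ENNReal.ofReal (‖z.1‖ / ‖z.2‖) * ENNReal.ofReal (‖z.2‖ / ‖z.1‖) = 1 := by
      rw [← ENNReal.ofReal_mul (by positivity)]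
      rw [show ‖z.1‖ / ‖z.2‖ * (‖z.2‖ / ‖z.1‖) = 1 by field_simp, ENNReal.ofReal_one]
    have e1 : G z = (f z.1 * ENNReal.ofReal (‖z.1‖ / ‖z.2‖)) ^ 2 *
        ENNReal.ofReal (1 / ‖z.1 - z.2‖ ^ 2) := by
      simp only [hG]
      rw [mul_pow, mul_assoc, mul_assoc, ← ENNReal.ofReal_mul (by positivity),
        ← ENNReal.ofReal_pow (by positivity), ← ENNReal.ofReal_mul (by positivity)]
      congr 2
      rw [div_pow, div_mul_div_comm, mul_one_div, mul_one, mul_comm (‖z.2‖ ^ 2)]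
    have e2 : G z.swap = (f z.2 * ENNReal.ofReal (‖z.2‖ / ‖z.1‖)) ^ 2 *
        ENNReal.ofReal (1 / ‖z.1 - z.2‖ ^ 2) := by
      simp only [hG, Prod.fst_swap, Prod.snd_swap]
      rw [mul_pow, mul_assoc, mul_assoc, ← ENNReal.ofReal_mul (by positivity),
        ← ENNReal.ofReal_pow (by positivity), ← ENNReal.ofReal_mul (by positivity)]
      congr 2
      rw [norm_sub_rev, div_pow, div_mul_div_comm, mul_one_div, mul_one, mul_comm (‖z.1‖ ^ 2)]
    rw [e1, e2, ← add_mul, ← mul_assoc]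
    gcongr
    refine le_trans (le_of_eq ?_) (two_mul_le_sq_add_sq _ _)
    rw [mul_mul_mul_comm, huv, mul_one]
  have h2 := lintegral_mono_ae h1
  rw [lintegral_const_mul' _ _ (by simp), lintegral_add_left' (by rwa [Measure.volume_eq_prod]),
    hGs, hGi, ← two_mul] at h2
  exact (ENNReal.mul_le_mul_iff_right (by simp) (by simp)).mp h2

/-! ### Positive kernels -/

/-- The sesquilinear integrand `conj f(p) f(q)`. -/
def tensorConj (f : R3 → ℂ) (z : R3 × R3) : ℂ := conj (f z.1) * f z.2

/-- Integrable functions with bounded support. -/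
structure BddSupp (f : R3 → ℂ) : Prop where
  integrable : Integrable f
  support : ∃ R, ∀ p, R < ‖p‖ → f p = 0

/-- Continuous real kernels that are positive on integrable functions of bounded support. -/
structure IsPosKernel (K : R3 × R3 → ℝ) : Prop where
  cont : Continuous K
  nonneg : ∀ f : R3 → ℂ, BddSupp f → 0 ≤ (∫ z, tensorConj f z * (K z : ℂ)).re

theorem norm_tensorConj (f : R3 → ℂ) (z : R3 × R3) : ‖tensorConj f z‖ = ‖f z.1‖ * ‖f z.2‖ := by
  simp [tensorConj]

theorem integrable_tensorConj {f : R3 → ℂ} (hf : Integrable f) : Integrable (tensorConj f) := by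
  rw [Measure.volume_eq_prod]
  exact Integrable.mul_prod
    ((Complex.conjLIE.toContinuousLinearEquiv.integrable_comp_iff).mpr hf) hf

theorem aestronglyMeasurable_tensorConj {f : R3 → ℂ} (hf : AEStronglyMeasurable f volume) :
    AEStronglyMeasurable (tensorConj f) volume := by
  have h1 : AEStronglyMeasurable (fun z : R3 × R3 => f z.1) volume :=
    hf.comp_quasiMeasurePreserving Measure.quasiMeasurePreserving_fst
  have h2 : AEStronglyMeasurable (fun z : R3 × R3 => f z.2) volume :=
    hf.comp_quasiMeasurePreserving Measure.quasiMeasurePreserving_snd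
  exact (Complex.continuous_conj.comp_aestronglyMeasurable h1).mul h2

theorem BddSupp.exists_bound {f : R3 → ℂ} (hf : BddSupp f) {B : R3 × R3 → ℝ} (hB : Continuous B) :
    ∃ C, ∀ z, tensorConj f z ≠ 0 → |B z| ≤ C := by
  obtain ⟨R, hR⟩ := hf.support
  have hc : IsCompact (Metric.closedBall (0 : R3) R ×ˢ Metric.closedBall (0 : R3) R) :=
    (isCompact_closedBall _ _).prod (isCompact_closedBall _ _)
  obtain ⟨C, hC⟩ := hc.exists_bound_of_continuousOn hB.continuousOn
  refine ⟨C, fun z hz => hC z ?_⟩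
  simp only [tensorConj, ne_eq, mul_eq_zero, map_eq_zero, not_or] at hz
  constructor
  · rw [mem_closedBall_zero_iff]; by_contra! h; exact hz.1 (hR _ h)
  · rw [mem_closedBall_zero_iff]; by_contra! h; exact hz.2 (hR _ h)

theorem BddSupp.integrable_tensorConj_mul {f : R3 → ℂ} (hf : BddSupp f) {K : R3 × R3 → ℝ}
    (hK : Continuous K) : Integrable (fun z => tensorConj f z * (K z : ℂ)) := by
  obtain ⟨C, hC⟩ := hf.exists_bound hK
  have hi := integrable_tensorConj hf.integrable
  refine (hi.norm.mul_const C).mono'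
    (hi.aestronglyMeasurable.mul (Complex.continuous_ofReal.comp hK).aestronglyMeasurable)
    (ae_of_all _ fun z => ?_)
  rw [norm_mul, Complex.norm_real, Real.norm_eq_abs]
  by_cases hz : tensorConj f z = 0
  · simp [hz]
  · gcongr; exact hC z hz

theorem BddSupp.mul_continuous {f : R3 → ℂ} (hf : BddSupp f) {φ : R3 → ℝ} (hφ : Continuous φ) :
    BddSupp fun p => f p * (φ p : ℂ) := by
  obtain ⟨R, hR⟩ := hf.support
  obtain ⟨C, hC⟩ := (isCompact_closedBall (0 : R3) R).exists_bound_of_continuousOn hφ.continuousOn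
  refine ⟨?_, R, fun p hp => by simp [hR p hp]⟩
  refine (hf.integrable.norm.mul_const C).mono' (hf.integrable.aestronglyMeasurable.mul
    (Complex.continuous_ofReal.comp hφ).aestronglyMeasurable) (ae_of_all _ fun p => ?_)
  rw [norm_mul, Complex.norm_real]
  by_cases hp : R < ‖p‖
  · simp [hR p hp]
  · gcongr; exact hC p (by simpa using hp)

namespace IsPosKernel

variable {K L : R3 × R3 → ℝ}

theorem one : IsPosKernel fun _ => 1 := by
  refine ⟨continuous_const, fun f _ => ?_⟩
  simp only [Complex.ofReal_one, mul_one, tensorConj]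
  rw [Measure.volume_eq_prod, integral_prod_mul (fun p => conj (f p)) f, integral_conj,
    ← Complex.normSq_eq_conj_mul_self]
  exact Complex.normSq_nonneg _

theorem add (hK : IsPosKernel K) (hL : IsPosKernel L) : IsPosKernel fun z => K z + L z := by
  refine ⟨hK.cont.add hL.cont, fun f hf => ?_⟩
  simp only [Complex.ofReal_add, mul_add]
  rw [integral_add (hf.integrable_tensorConj_mul hK.cont) (hf.integrable_tensorConj_mul hL.cont),
    Complex.add_re]
  exact add_nonneg (hK.nonneg f hf) (hL.nonneg f hf)

theorem const_mul (hK : IsPosKernel K) {c : ℝ} (hc : 0 ≤ c) : IsPosKernel fun z => c * K z := by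
  refine ⟨hK.cont.const_mul c, fun f hf => ?_⟩
  simp only [Complex.ofReal_mul, mul_left_comm _ (c : ℂ)]
  rw [integral_const_mul, Complex.re_ofReal_mul]
  exact mul_nonneg hc (hK.nonneg f hf)

/-- The factor φ is absorbed into the test function. -/
theorem mul_tensor (hK : IsPosKernel K) {φ : R3 → ℝ} (hφ : Continuous φ) :
    IsPosKernel fun z => K z * (φ z.1 * φ z.2) := by
  refine ⟨hK.cont.mul (by fun_prop), fun f hf => ?_⟩
  convert hK.nonneg _ (hf.mul_continuous hφ) using 4 with z
  simp only [tensorConj, map_mul, Complex.conj_ofReal, Complex.ofReal_mul]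
  ring

theorem zero : IsPosKernel fun _ => 0 := by
  simpa using one.const_mul le_rfl

theorem sum {ι : Type*} (s : Finset ι) {K : ι → R3 × R3 → ℝ} (hK : ∀ i ∈ s, IsPosKernel (K i)) :
    IsPosKernel fun z => ∑ i ∈ s, K i z := by
  classical
  induction s using Finset.induction_on with
  | empty => simpa using zero
  | insert a s ha ih =>
    simp only [Finset.sum_insert ha]
    exact (hK a (by simp)).add (ih fun i hi => hK i (by simp [hi]))

/-- The case of the Schur product theorem needed here: p·q is the sum of the three tensors pᵢqᵢ. -/
theorem mul_inner (hK : IsPosKernel K) : IsPosKernel fun z => K z * inner ℝ z.1 z.2 := by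
  have h := sum Finset.univ fun (i : Fin 3) _ => hK.mul_tensor (φ := fun p => p i) (by fun_prop)
  convert h using 2 with z
  rw [← Finset.mul_sum, PiLp.inner_apply]
  simp [mul_comm]

theorem mul_inner_pow (hK : IsPosKernel K) (n : ℕ) :
    IsPosKernel fun z => K z * (inner ℝ z.1 z.2) ^ n := by
  induction n with
  | zero => simpa using hK
  | succ n ih => simpa [pow_succ, mul_assoc] using ih.mul_inner

theorem of_tendsto {K : ℕ → R3 × R3 → ℝ} {L B : R3 × R3 → ℝ} (hK : ∀ n, IsPosKernel (K n))
    (hL : Continuous L) (hB : Continuous B) (hKB : ∀ n z, |K n z| ≤ B z)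
    (hlim : ∀ z, Tendsto (fun n => K n z) atTop (𝓝 (L z))) : IsPosKernel L := by
  refine ⟨hL, fun f hf => ?_⟩
  have h : Tendsto (fun n => ∫ z, tensorConj f z * (K n z : ℂ)) atTop
      (𝓝 (∫ z, tensorConj f z * (L z : ℂ))) := by
    refine tendsto_integral_of_dominated_convergence (fun z => ‖tensorConj f z * (B z : ℂ)‖)
      (fun n => (hf.integrable_tensorConj_mul (hK n).cont).aestronglyMeasurable)
      (hf.integrable_tensorConj_mul hB).norm (fun n => ae_of_all _ fun z => ?_)
      (ae_of_all _ fun z => ?_)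
    · rw [norm_mul, norm_mul, Complex.norm_real, Complex.norm_real]
      gcongr
      exact (hKB n z).trans (le_abs_self _)
    · exact ((Complex.continuous_ofReal.tendsto _).comp (hlim z)).const_mul _
  exact ge_of_tendsto' ((Complex.continuous_re.tendsto _).comp h) fun n => (hK n).nonneg f hf

end IsPosKernel

theorem hasSum_real_exp (x : ℝ) : HasSum (fun n : ℕ => x ^ n / n.factorial) (Real.exp x) := by
  rw [Real.exp_eq_exp_ℝ]
  exact NormedSpace.expSeries_div_hasSum_exp x

theorem abs_sum_exp_le (x : ℝ) (n : ℕ) :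
    |∑ i ∈ Finset.range n, x ^ i / (i.factorial : ℝ)| ≤ Real.exp |x| := by
  refine (Finset.abs_sum_le_sum_abs _ _).trans ?_
  refine le_trans (le_of_eq ?_) (Real.sum_le_exp_of_nonneg (abs_nonneg x) n)
  refine Finset.sum_congr rfl fun i _ => ?_
  rw [abs_div, abs_pow, Nat.abs_cast]

/-- Factor out e^{-tp²}e^{-tq²}: what is left is e^{2t p·q} - c e^{-t p·q}, a power series in p·q
with coefficients `a n`. They are nonnegative because 2ⁿ ≥ 1 ≥ c(-1)ⁿ, and the partial sums converge
under a continuous majorant. -/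
theorem isPosKernel_exp_sub {t c : ℝ} (ht : 0 ≤ t) (hc0 : 0 ≤ c) (hc1 : c ≤ 1) :
    IsPosKernel fun z => Real.exp (-t * ‖z.1 - z.2‖ ^ 2)
      - c * Real.exp (-t * (‖z.1‖ ^ 2 + ‖z.2‖ ^ 2 + inner ℝ z.1 z.2)) := by
  set φ : R3 → ℝ := fun p => Real.exp (-t * ‖p‖ ^ 2) with hφ
  have hφc : Continuous φ := by fun_prop
  have hg : IsPosKernel fun z => φ z.1 * φ z.2 := by
    simpa using IsPosKernel.one.mul_tensor hφc
  set a : ℕ → ℝ := fun n => t ^ n / n.factorial * (2 ^ n - c * (-1) ^ n) with ha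
  have ha0 : ∀ n, 0 ≤ a n := by
    intro n
    refine mul_nonneg (by positivity) ?_
    have h1 : (1 : ℝ) ≤ 2 ^ n := one_le_pow₀ (by norm_num)
    have h2 : c * (-1) ^ n ≤ 1 := by
      rcases neg_one_pow_eq_or ℝ n with h | h <;> rw [h] <;> linarith
    linarith
  have hsplit : ∀ (N : ℕ) (z : R3 × R3),
      ∑ n ∈ Finset.range N, a n * (φ z.1 * φ z.2 * (inner ℝ z.1 z.2) ^ n) =
      φ z.1 * φ z.2 * (∑ n ∈ Finset.range N, (2 * t * inner ℝ z.1 z.2) ^ n / (n.factorial : ℝ)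
        - c * ∑ n ∈ Finset.range N, (-t * inner ℝ z.1 z.2) ^ n / (n.factorial : ℝ)) := by
    intro N z
    rw [Finset.mul_sum, ← Finset.sum_sub_distrib, Finset.mul_sum]
    refine Finset.sum_congr rfl fun n _ => ?_
    have h : (-t * inner ℝ z.1 z.2) ^ n = (-1) ^ n * t ^ n * inner ℝ z.1 z.2 ^ n := by
      rw [← neg_one_mul t, mul_pow, mul_pow]
    simp only [ha, h, mul_pow]
    ring
  refine IsPosKernel.of_tendsto
    (K := fun N z => ∑ n ∈ Finset.range N, a n * (φ z.1 * φ z.2 * (inner ℝ z.1 z.2) ^ n))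
    (B := fun z => φ z.1 * φ z.2 * (Real.exp |2 * t * inner ℝ z.1 z.2|
      + c * Real.exp |-t * inner ℝ z.1 z.2|))
    (fun N => IsPosKernel.sum _ fun n _ => (hg.mul_inner_pow n).const_mul (ha0 n))
    (by fun_prop) (by fun_prop) ?_ ?_
  · intro N z
    have hφ0 : 0 ≤ φ z.1 * φ z.2 := by positivity
    rw [hsplit, abs_mul, abs_of_nonneg hφ0]
    gcongr
    refine (abs_sub _ _).trans ?_
    rw [abs_mul, abs_of_nonneg hc0]
    gcongr
    · exact abs_sum_exp_le _ _
    · exact abs_sum_exp_le _ _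
  · intro z
    simp only [hsplit]
    have h1 := (hasSum_real_exp (2 * t * inner ℝ z.1 z.2)).tendsto_sum_nat
    have h2 := (hasSum_real_exp (-t * inner ℝ z.1 z.2)).tendsto_sum_nat
    convert (h1.sub (h2.const_mul c)).const_mul (φ z.1 * φ z.2) using 2
    simp only [hφ]
    rw [mul_sub, mul_left_comm _ c, ← Real.exp_add, ← Real.exp_add, ← Real.exp_add,
      norm_sub_sq_real]
    congr 2
    · ring_nf
    · ring_nf

/-! ### Laplace transform and the comparison off ≤ reg -/

theorem integral_exp_neg_mul {a : ℝ} (ha : 0 < a) :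
    ∫ t in Set.Ioi (0 : ℝ), Real.exp (-t * a) = 1 / a := by
  have := integral_exp_mul_Ioi (neg_lt_zero.mpr ha) 0
  rw [mul_zero, Real.exp_zero, neg_div_neg_eq] at this
  simpa only [neg_mul, mul_comm a] using this

/-- Justifies exchanging the t-integral with the z-integral: integrating the absolute value over t
first gives back |F|/a. -/
theorem integrable_mul_exp {Z : Type*} [MeasurableSpace Z] {μ : Measure Z} [SFinite μ]
    {F : Z → ℂ} {a : Z → ℝ} (hF : AEStronglyMeasurable F μ) (ham : Measurable a)
    (ha : ∀ᵐ z ∂μ, 0 < a z) (hi : Integrable (fun z => F z / (a z : ℂ)) μ) :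
    Integrable (fun w : Z × ℝ => F w.1 * (Real.exp (-w.2 * a w.1) : ℂ))
      (μ.prod (volume.restrict (Set.Ioi 0))) := by
  have hm : AEStronglyMeasurable (fun w : Z × ℝ => F w.1 * (Real.exp (-w.2 * a w.1) : ℂ))
      (μ.prod (volume.restrict (Set.Ioi 0))) := by
    refine AEStronglyMeasurable.mul
      (hF.comp_quasiMeasurePreserving Measure.quasiMeasurePreserving_fst) ?_
    refine Measurable.aestronglyMeasurable ?_
    fun_prop
  have hexp : ∀ z, 0 < a z → IntegrableOn (fun t : ℝ => Real.exp (-t * a z)) (Set.Ioi 0) := by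
    intro z hz
    have := integrableOn_exp_mul_Ioi (neg_lt_zero.mpr hz) 0
    simpa [mul_comm] using this
  rw [integrable_prod_iff hm]
  constructor
  · filter_upwards [ha] with z hz
    exact ((hexp z hz).ofReal).const_mul _
  · refine hi.norm.congr ?_
    filter_upwards [ha] with z hz
    simp only [norm_mul, Complex.norm_real, Real.norm_eq_abs, Real.abs_exp, norm_div]
    rw [integral_const_mul, integral_exp_neg_mul hz, abs_of_pos hz, mul_one_div]

theorem integral_mul_exp {F : ℂ} {a : ℝ} (ha : 0 < a) :
    ∫ t in Set.Ioi (0 : ℝ), F * (Real.exp (-t * a) : ℂ) = F / (a : ℂ) := by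
  rw [integral_const_mul, integral_complex_ofReal, integral_exp_neg_mul ha]
  push_cast
  ring

/-- The denominator `p² + q² + p·q + λ`. -/
def offDenom (lam : ℝ) (z : R3 × R3) : ℝ := ‖z.1‖ ^ 2 + ‖z.2‖ ^ 2 + inner ℝ z.1 z.2 + lam

theorem ae_fst_ne_snd : ∀ᵐ z : R3 × R3, z.1 ≠ z.2 := by
  have : ∀ᵐ z ∂((volume : Measure R3).prod volume), z.1 ≠ z.2 := by
    have hm : MeasurableSet {z : R3 × R3 | z.1 ≠ z.2} :=
      (measurableSet_eq_fun measurable_fst measurable_snd).compl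
    rw [Measure.ae_prod_iff_ae_ae hm]
    exact ae_of_all _ fun p => (Measure.ae_ne volume p).mono fun q hq => hq.symm
  exact this

/-- The difference of the two sides is 3|p+q|² + 4λ. -/
theorem normSq_sub_le_offDenom {lam : ℝ} (hl : 0 ≤ lam) (z : R3 × R3) :
    ‖z.1 - z.2‖ ^ 2 ≤ 4 * offDenom lam z := by
  have h1 := norm_sub_sq_real z.1 z.2
  have h2 := norm_add_sq_real z.1 z.2
  have h3 := sq_nonneg ‖z.1 + z.2‖
  have h4 := sq_nonneg ‖z.1‖
  have h5 := sq_nonneg ‖z.2‖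
  unfold offDenom
  nlinarith

theorem ae_sub_pos : ∀ᵐ z : R3 × R3, 0 < ‖z.1 - z.2‖ ^ 2 := by
  filter_upwards [ae_fst_ne_snd] with z hz
  have := norm_pos_iff.mpr (sub_ne_zero.mpr hz)
  positivity

theorem ae_offDenom_pos {lam : ℝ} (hl : 0 ≤ lam) : ∀ᵐ z : R3 × R3, 0 < offDenom lam z := by
  filter_upwards [ae_sub_pos] with z hz
  linarith [normSq_sub_le_offDenom hl z]

theorem continuous_offDenom (lam : ℝ) : Continuous (offDenom lam) := by
  unfold offDenom
  fun_prop

theorem norm_div_offDenom_le {lam : ℝ} (hl : 0 ≤ lam) (w : ℂ) {z : R3 × R3}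
    (hz : 0 < ‖z.1 - z.2‖ ^ 2) :
    ‖w / (offDenom lam z : ℂ)‖ ≤ 4 * ‖w / ((‖z.1 - z.2‖ ^ 2 : ℝ) : ℂ)‖ := by
  have h1 := normSq_sub_le_offDenom hl z
  rw [norm_div, norm_div, Complex.norm_real, Complex.norm_real, Real.norm_of_nonneg hz.le,
    Real.norm_of_nonneg (by linarith), mul_div_assoc', div_le_div_iff₀ (by linarith) hz]
  nlinarith [norm_nonneg w]

theorem integrable_off_of_reg {f : R3 → ℂ} {lam : ℝ} (hl : 0 ≤ lam)
    (hf : AEStronglyMeasurable f volume)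
    (hi : Integrable (fun z => tensorConj f z / ((‖z.1 - z.2‖ ^ 2 : ℝ) : ℂ))) :
    Integrable (fun z => tensorConj f z / (offDenom lam z : ℂ)) := by
  refine (hi.norm.const_mul 4).mono' ?_ ?_
  · refine (aestronglyMeasurable_tensorConj hf).aemeasurable.div ?_ |>.aestronglyMeasurable
    exact (Complex.measurable_ofReal.comp (continuous_offDenom lam).measurable).aemeasurable
  · filter_upwards [ae_sub_pos] with z hz
    exact norm_div_offDenom_le hl _ hz

theorem re_off_le_reg_of_bddSupp {f : R3 → ℂ} {lam c : ℝ} (hl : 0 ≤ lam) (hc0 : 0 ≤ c)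
    (hc1 : c ≤ 1) (hf : BddSupp f)
    (hi : Integrable (fun z => tensorConj f z / ((‖z.1 - z.2‖ ^ 2 : ℝ) : ℂ))) :
    c * (∫ z, tensorConj f z / (offDenom lam z : ℂ)).re
      ≤ (∫ z, tensorConj f z / ((‖z.1 - z.2‖ ^ 2 : ℝ) : ℂ)).re := by
  have hfm := hf.integrable.aestronglyMeasurable
  have hTm := aestronglyMeasurable_tensorConj hfm
  have hoff := integrable_off_of_reg hl hfm hi
  have hr := integrable_mul_exp hTm (by fun_prop) ae_sub_pos hi
  have ho := integrable_mul_exp hTm (continuous_offDenom lam).measurable (ae_offDenom_pos hl) hoff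
  set μ : Measure ℝ := volume.restrict (Set.Ioi 0)
  set G : (R3 × R3) → ℝ → ℂ := fun z t => tensorConj f z * (Real.exp (-t * ‖z.1 - z.2‖ ^ 2) : ℂ)
    - c * (tensorConj f z * (Real.exp (-t * offDenom lam z) : ℂ)) with hG
  have hGi : Integrable (Function.uncurry G) (volume.prod μ) := hr.sub (ho.const_mul (c : ℂ))
  have h1 : (∫ z, tensorConj f z / ((‖z.1 - z.2‖ ^ 2 : ℝ) : ℂ))
      - c * (∫ z, tensorConj f z / (offDenom lam z : ℂ)) = ∫ t, ∫ z, G z t ∂volume ∂μ := by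
    rw [← integral_integral_swap hGi, ← integral_const_mul, ← integral_sub hi (hoff.const_mul _)]
    refine integral_congr_ae ?_
    filter_upwards [ae_sub_pos, ae_offDenom_pos hl, hr.prod_right_ae, ho.prod_right_ae]
      with z hz1 hz2 hz3 hz4
    simp only [hG]
    rw [integral_sub hz3 (hz4.const_mul _), integral_mul_exp hz1, integral_const_mul,
      integral_mul_exp hz2]
  have h2 : 0 ≤ (∫ t, ∫ z, G z t ∂volume ∂μ).re := by
    have h3 := integral_re hGi.integral_prod_right
    refine le_of_le_of_eq ?_ h3
    refine integral_nonneg_of_ae ((ae_restrict_iff' measurableSet_Ioi).mpr (ae_of_all _ ?_))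
    intro t ht
    have ht0 : (0 : ℝ) < t := ht
    -- The factor e^{-tλ} of the off-diagonal kernel goes into the constant, which stays in [0, 1].
    have hk := isPosKernel_exp_sub (t := t) (c := c * Real.exp (-t * lam)) ht0.le (by positivity)
      (mul_le_one₀ hc1 (Real.exp_nonneg _) (Real.exp_le_one_iff.mpr (by nlinarith)))
    have h4 := hk.nonneg f hf
    refine le_of_le_of_eq h4 (congrArg Complex.re (integral_congr_ae (ae_of_all _ fun z => ?_)))
    simp only [hG, Function.uncurry_apply_pair]
    rw [mul_assoc c, ← Real.exp_add]
    simp only [offDenom]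
    push_cast
    ring_nf
  rw [← h1, Complex.sub_re, Complex.re_ofReal_mul] at h2
  linarith

/-- Cutting f off to balls reduces to bounded support, and dominated convergence removes the cutoff.
The parameter c serves two ends: c = 1 compares off with reg, c = 0 gives reg ≥ 0. -/
theorem re_off_le_reg {f : R3 → ℂ} {lam c : ℝ} (hl : 0 ≤ lam) (hc0 : 0 ≤ c)
    (hc1 : c ≤ 1) (hf : MemLp f 2 volume)
    (hi : Integrable (fun z => tensorConj f z / ((‖z.1 - z.2‖ ^ 2 : ℝ) : ℂ))) :
    c * (∫ z, tensorConj f z / (offDenom lam z : ℂ)).re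
      ≤ (∫ z, tensorConj f z / ((‖z.1 - z.2‖ ^ 2 : ℝ) : ℂ)).re := by
  set g : ℕ → R3 → ℂ := fun n => (Metric.closedBall (0 : R3) n).indicator f with hg
  have hgm : ∀ n, AEStronglyMeasurable (g n) volume := fun n =>
    hf.1.indicator measurableSet_closedBall
  have hgb : ∀ n, BddSupp (g n) := by
    intro n
    refine ⟨?_, n, fun p hp => Set.indicator_of_notMem (by simpa using hp) _⟩
    rw [hg, integrable_indicator_iff measurableSet_closedBall]
    have : IsFiniteMeasure ((volume : Measure R3).restrict (Metric.closedBall 0 n)) :=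
      ⟨by
        rw [Measure.restrict_apply_univ]
        exact measure_closedBall_lt_top⟩
    exact (hf.restrict _).integrable one_le_two
  have hle : ∀ n p, ‖g n p‖ ≤ ‖f p‖ := fun n p => norm_indicator_le_norm_self _ _
  have hT : ∀ n z, ‖tensorConj (g n) z‖ ≤ ‖tensorConj f z‖ := by
    intro n z
    rw [norm_tensorConj, norm_tensorConj]
    exact mul_le_mul (hle _ _) (hle _ _) (norm_nonneg _) (norm_nonneg _)
  have hgl : ∀ p, ∀ᶠ n in atTop, g n p = f p := by
    intro p
    filter_upwards [eventually_ge_atTop ⌈‖p‖⌉₊] with n hn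
    exact Set.indicator_of_mem (by simpa using Nat.ceil_le.mp hn) _
  have hlim : ∀ D : R3 × R3 → ℝ, Continuous D → Integrable (fun z => tensorConj f z / (D z : ℂ)) →
      (∀ n, Integrable (fun z => tensorConj (g n) z / (D z : ℂ))) ∧
      Tendsto (fun n => (∫ z, tensorConj (g n) z / (D z : ℂ)).re) atTop
        (𝓝 (∫ z, tensorConj f z / (D z : ℂ)).re) := by
    intro D hD hDi
    have hm : ∀ n, AEStronglyMeasurable (fun z => tensorConj (g n) z / (D z : ℂ)) volume := by
      intro n
      refine (aestronglyMeasurable_tensorConj (hgm n)).aemeasurable.div ?_ |>.aestronglyMeasurable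
      exact (Complex.measurable_ofReal.comp hD.measurable).aemeasurable
    have hb : ∀ n, ∀ᵐ z, ‖tensorConj (g n) z / (D z : ℂ)‖ ≤ ‖tensorConj f z / (D z : ℂ)‖ := by
      intro n
      refine ae_of_all _ fun z => ?_
      rw [norm_div, norm_div]
      exact div_le_div_of_nonneg_right (hT n z) (norm_nonneg _)
    refine ⟨fun n => hDi.norm.mono' (hm n) (hb n), (Complex.continuous_re.tendsto _).comp
      (tendsto_integral_of_dominated_convergence _ hm hDi.norm hb (ae_of_all _ fun z => ?_))⟩
    refine tendsto_const_nhds.congr' ?_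
    filter_upwards [hgl z.1, hgl z.2] with n h1 h2
    simp [tensorConj, h1, h2]
  obtain ⟨hri, hrl⟩ := hlim (fun z => ‖z.1 - z.2‖ ^ 2) (by fun_prop) hi
  obtain ⟨-, hol⟩ := hlim _ (continuous_offDenom lam) (integrable_off_of_reg hl hf.1 hi)
  exact le_of_tendsto_of_tendsto' (hol.const_mul c) hrl
    fun n => re_off_le_reg_of_bddSupp hl hc0 hc1 (hgb n) (hri n)

/-! ### Bounds on the four terms and on the form -/

/-- The kinetic energy `∫ |p| |ξ̂(p)|² dp`. -/
def kinetic (ξ : L2R3) : ℝ := ∫ p, ‖p‖ * ‖hat ξ p‖ ^ 2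

theorem enorm_mul_enorm_hat_sq (ξ : L2R3) (p : R3) :
    ‖p‖ₑ * ‖hat ξ p‖ₑ ^ 2 = ENNReal.ofReal (‖p‖ * ‖hat ξ p‖ ^ 2) := by
  rw [ENNReal.ofReal_mul (norm_nonneg _), ENNReal.ofReal_pow (norm_nonneg _), ofReal_norm,
    ofReal_norm]

theorem integrable_kinetic {ξ : L2R3} (hξ : ξ ∈ HHalf) :
    Integrable (fun p : R3 => ‖p‖ * ‖hat ξ p‖ ^ 2) := by
  refine ⟨continuous_norm.aestronglyMeasurable.mul ((aestronglyMeasurable_hat ξ).norm.pow 2), ?_⟩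
  rw [hasFiniteIntegral_iff_ofReal (ae_of_all _ fun p => by positivity)]
  simpa only [enorm_mul_enorm_hat_sq] using (mem_HHalf_iff ξ).mp hξ

theorem ofReal_kinetic {ξ : L2R3} (hξ : ξ ∈ HHalf) :
    ENNReal.ofReal (kinetic ξ) = ∫⁻ p, ‖p‖ₑ * ‖hat ξ p‖ₑ ^ 2 := by
  simp only [enorm_mul_enorm_hat_sq]
  exact ofReal_integral_eq_lintegral_ofReal (integrable_kinetic hξ)
    (ae_of_all _ fun p => by positivity)

theorem kinetic_nonneg (ξ : L2R3) : 0 ≤ kinetic ξ := integral_nonneg fun p => by positivity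

theorem integral_norm_sq_of_lintegral {f : R3 → ℂ} (hf : MemLp f 2 volume) {a : ℝ} (ha : 0 ≤ a)
    (h : ∫⁻ p, ‖f p‖ₑ ^ 2 = ENNReal.ofReal a) : ∫ p, ‖f p‖ ^ 2 = a := by
  rw [integral_eq_lintegral_of_nonneg_ae (ae_of_all _ fun p => by positivity)
    (hf.integrable_norm_pow two_ne_zero).1]
  simp only [ENNReal.ofReal_pow (norm_nonneg _), ofReal_norm]
  rw [h, ENNReal.toReal_ofReal ha]

theorem enorm_sq_eq (ξ : L2R3) : ‖ξ‖ₑ ^ 2 = ENNReal.ofReal (‖ξ‖ ^ 2) := by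
  rw [ENNReal.ofReal_pow (norm_nonneg _), ofReal_norm]

theorem integral_norm_hat_sq (ξ : L2R3) : ∫ p, ‖hat ξ p‖ ^ 2 = ‖ξ‖ ^ 2 :=
  integral_norm_sq_of_lintegral (memLp_hat ξ) (by positivity)
    (by rw [lintegral_enorm_hat_sq, enorm_sq_eq])

theorem integral_norm_sq (ξ : L2R3) : ∫ x, ‖ξ x‖ ^ 2 = ‖ξ‖ ^ 2 :=
  integral_norm_sq_of_lintegral (Lp.memLp ξ) (by positivity)
    (by rw [← eLpNorm_two_sq, ← Lp.enorm_def, enorm_sq_eq])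

theorem lintegral_enorm_reg_le {ξ : L2R3} (hξ : ξ ∈ HHalf) :
    ∫⁻ z, ‖regIntegrand ξ z‖ₑ ≤ ENNReal.ofReal (Real.pi ^ 3 * kinetic ξ) := by
  rw [ENNReal.ofReal_mul (by positivity), ofReal_kinetic hξ]
  refine le_trans (le_of_eq (lintegral_congr fun z => ?_))
    (lintegral_schur (aestronglyMeasurable_hat ξ).enorm)
  rw [← ofReal_norm, ← ofReal_norm, ← ofReal_norm, ← ENNReal.ofReal_mul (norm_nonneg _),
    ← ENNReal.ofReal_mul (by positivity)]
  congr 1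
  rw [regIntegrand, norm_div, norm_mul, Complex.norm_real, RCLike.norm_conj,
    Real.norm_of_nonneg (by positivity), mul_one_div]

theorem integrable_regIntegrand {ξ : L2R3} (hξ : ξ ∈ HHalf) : Integrable (regIntegrand ξ) := by
  refine ⟨?_, (lintegral_enorm_reg_le hξ).trans_lt ENNReal.ofReal_lt_top⟩
  refine (aestronglyMeasurable_tensorConj (aestronglyMeasurable_hat ξ)).aemeasurable.div ?_
    |>.aestronglyMeasurable
  exact (Complex.measurable_ofReal.comp (by fun_prop)).aemeasurable

theorem integral_norm_reg_le {ξ : L2R3} (hξ : ξ ∈ HHalf) :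
    ∫ z, ‖regIntegrand ξ z‖ ≤ Real.pi ^ 3 * kinetic ξ := by
  have hk := kinetic_nonneg ξ
  rw [integral_norm_eq_lintegral_enorm (integrable_regIntegrand hξ).1]
  exact ENNReal.toReal_le_of_le_ofReal (by positivity) (lintegral_enorm_reg_le hξ)

theorem integrable_offIntegrand {ξ : L2R3} (hξ : ξ ∈ HHalf) {lam : ℝ} (hl : 0 ≤ lam) :
    Integrable (offIntegrand lam ξ) :=
  integrable_off_of_reg hl (aestronglyMeasurable_hat ξ) (integrable_regIntegrand hξ)

theorem integral_norm_off_le {ξ : L2R3} (hξ : ξ ∈ HHalf) {lam : ℝ} (hl : 0 ≤ lam) :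
    ∫ z, ‖offIntegrand lam ξ z‖ ≤ 4 * (Real.pi ^ 3 * kinetic ξ) := by
  refine le_trans ?_ (mul_le_mul_of_nonneg_left (integral_norm_reg_le hξ) zero_le_four)
  rw [← integral_const_mul]
  refine integral_mono_ae (integrable_offIntegrand hξ hl).norm
    ((integrable_regIntegrand hξ).norm.const_mul 4) ?_
  filter_upwards [ae_sub_pos] with z hz
  exact norm_div_offDenom_le hl _ hz

theorem re_off_le_re_reg {ξ : L2R3} (hξ : ξ ∈ HHalf) {lam : ℝ} (hl : 0 ≤ lam) :
    (∫ z, offIntegrand lam ξ z).re ≤ (∫ z, regIntegrand ξ z).re := by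
  have h := re_off_le_reg hl zero_le_one le_rfl (memLp_hat ξ) (integrable_regIntegrand hξ)
  rwa [one_mul] at h

theorem re_reg_nonneg {ξ : L2R3} (hξ : ξ ∈ HHalf) : 0 ≤ (∫ z, regIntegrand ξ z).re := by
  have h := re_off_le_reg le_rfl le_rfl zero_le_one (memLp_hat ξ) (integrable_regIntegrand hξ)
  rwa [zero_mul] at h

theorem re_reg_le {ξ : L2R3} (hξ : ξ ∈ HHalf) :
    (∫ z, regIntegrand ξ z).re ≤ Real.pi ^ 3 * kinetic ξ :=
  (Complex.re_le_norm _).trans ((norm_integral_le_integral_norm _).trans (integral_norm_reg_le hξ))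

/-- The integral of a function that the exchange of variables conjugates is real. -/
theorem im_integral_eq_zero_of_swap {F : R3 × R3 → ℂ} (hF : ∀ z, F z.swap = conj (F z)) :
    (∫ z, F z).im = 0 := by
  have h : ∫ z : R3 × R3, F z.swap = ∫ z, F z := integral_prod_swap F
  simp only [hF] at h
  rw [integral_conj] at h
  exact Complex.conj_eq_iff_im.mp h

theorem im_integral_off (lam : ℝ) (ξ : L2R3) : (∫ z, offIntegrand lam ξ z).im = 0 := by
  refine im_integral_eq_zero_of_swap fun z => ?_
  simp only [offIntegrand, Prod.fst_swap, Prod.snd_swap, map_div₀, map_mul, Complex.conj_conj,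
    Complex.conj_ofReal, real_inner_comm z.2 z.1, add_comm (‖z.2‖ ^ 2)]
  ring

theorem im_integral_reg (ξ : L2R3) : (∫ z, regIntegrand ξ z).im = 0 := by
  refine im_integral_eq_zero_of_swap fun z => ?_
  simp only [regIntegrand, Prod.fst_swap, Prod.snd_swap, map_div₀, map_mul, Complex.conj_conj,
    Complex.conj_ofReal, norm_sub_rev z.2 z.1]
  ring

theorem integrable_norm_hat_sq (ξ : L2R3) : Integrable (fun p => ‖hat ξ p‖ ^ 2) :=
  (memLp_hat ξ).integrable_norm_pow two_ne_zero

theorem integrable_norm_sq (ξ : L2R3) : Integrable (fun x => ‖ξ x‖ ^ 2) :=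
  (Lp.memLp ξ).integrable_norm_pow two_ne_zero

theorem sqrt_diag_le {lam : ℝ} (hl : 0 ≤ lam) {r : ℝ} (hr : 0 ≤ r) :
    √(3 / 4 * r ^ 2 + lam) ≤ r + √lam := by
  refine Real.sqrt_le_iff.mpr ⟨by positivity, ?_⟩
  nlinarith [Real.sq_sqrt hl, mul_nonneg hr (Real.sqrt_nonneg lam)]

theorem integrable_diagIntegrand {ξ : L2R3} (hξ : ξ ∈ HHalf) {lam : ℝ} (hl : 0 ≤ lam) :
    Integrable (diagIntegrand lam ξ) := by
  refine ((integrable_kinetic hξ).add ((integrable_norm_hat_sq ξ).const_mul √lam)).mono' ?_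
    (ae_of_all _ fun p => ?_)
  · refine Continuous.aestronglyMeasurable (by fun_prop) |>.mul
      ((aestronglyMeasurable_hat ξ).norm.pow 2)
  · rw [diagIntegrand, Real.norm_of_nonneg (by positivity), Pi.add_apply, ← add_mul]
    gcongr
    exact sqrt_diag_le hl (norm_nonneg _)

theorem integral_diag_le {ξ : L2R3} (hξ : ξ ∈ HHalf) {lam : ℝ} (hl : 0 ≤ lam) :
    ∫ p, diagIntegrand lam ξ p ≤ kinetic ξ + √lam * ‖ξ‖ ^ 2 := by
  rw [← integral_norm_hat_sq, ← integral_const_mul, kinetic,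
    ← integral_add (integrable_kinetic hξ) ((integrable_norm_hat_sq ξ).const_mul _)]
  refine integral_mono (integrable_diagIntegrand hξ hl)
    ((integrable_kinetic hξ).add ((integrable_norm_hat_sq ξ).const_mul _)) fun p => ?_
  simp only [diagIntegrand, ← add_mul]
  gcongr
  exact sqrt_diag_le hl (norm_nonneg _)

section Potential

variable {γ 𝔞 b : ℝ} {θ : ℝ → ℝ}

theorem measurable_beta (hθm : Measurable θ) : Measurable (beta γ 𝔞 θ) := by
  unfold beta
  fun_prop

theorem abs_beta_le (hb : 0 < b)
    (hθ : ∀ s : ℝ, 0 ≤ s → 1 - s / b ≤ θ s ∧ θ s ≤ 1 + s / b) (y : R3) :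
    |beta γ 𝔞 θ y| ≤ |1 / 𝔞| + |γ| / b := by
  have h : |(θ ‖y‖ - 1) / ‖y‖| ≤ 1 / b := by
    rcases (norm_nonneg y).eq_or_lt with h0 | h0
    -- At y = 0 the quotient is 0, because division by zero gives 0.
    · rw [← h0]; simpa using hb.le
    · obtain ⟨h1, h2⟩ := hθ ‖y‖ h0.le
      rw [abs_div, abs_of_pos h0, div_le_iff₀ h0, abs_le, one_div_mul_eq_div]
      constructor <;> linarith
  calc |beta γ 𝔞 θ y| ≤ |-1 / 𝔞| + |γ * ((θ ‖y‖ - 1) / ‖y‖)| := abs_add_le _ _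
    _ = |1 / 𝔞| + |γ| * |(θ ‖y‖ - 1) / ‖y‖| := by rw [neg_div, abs_neg, abs_mul]
    _ ≤ |1 / 𝔞| + |γ| * (1 / b) := by gcongr
    _ = _ := by ring

theorem integrable_zeroIntegrand (hb : 0 < b) (hθm : Measurable θ)
    (hθ : ∀ s : ℝ, 0 ≤ s → 1 - s / b ≤ θ s ∧ θ s ≤ 1 + s / b) (ξ : L2R3) :
    Integrable (zeroIntegrand γ 𝔞 θ ξ) :=
  (integrable_norm_sq ξ).bdd_mul (measurable_beta hθm).aestronglyMeasurable
    (ae_of_all _ (abs_beta_le hb hθ))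

theorem abs_integral_zero_le (hb : 0 < b)
    (hθ : ∀ s : ℝ, 0 ≤ s → 1 - s / b ≤ θ s ∧ θ s ≤ 1 + s / b) (ξ : L2R3) :
    |∫ y, zeroIntegrand γ 𝔞 θ ξ y| ≤ (|1 / 𝔞| + |γ| / b) * ‖ξ‖ ^ 2 := by
  rw [← integral_norm_sq, ← integral_const_mul, ← Real.norm_eq_abs]
  refine norm_integral_le_of_norm_le ((integrable_norm_sq ξ).const_mul _) (ae_of_all _ fun y => ?_)
  rw [zeroIntegrand, norm_mul, Real.norm_eq_abs, Real.norm_of_nonneg (by positivity)]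
  gcongr
  exact abs_beta_le hb hθ y

theorem essInf_beta_mul_le (hb : 0 < b) (hθm : Measurable θ)
    (hθ : ∀ s : ℝ, 0 ≤ s → 1 - s / b ≤ θ s ∧ θ s ≤ 1 + s / b) (ξ : L2R3) :
    essInf (beta γ 𝔞 θ) volume * ‖ξ‖ ^ 2 ≤ ∫ y, zeroIntegrand γ 𝔞 θ ξ y := by
  have hbd : IsBoundedUnder (· ≥ ·) (ae (volume : Measure R3)) (beta γ 𝔞 θ) :=
    isBoundedUnder_of ⟨-(|1 / 𝔞| + |γ| / b), fun y => (abs_le.mp (abs_beta_le hb hθ y)).1⟩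
  rw [← integral_norm_sq, ← integral_const_mul]
  refine integral_mono_ae ((integrable_norm_sq ξ).const_mul _)
    (integrable_zeroIntegrand hb hθm hθ ξ) ?_
  filter_upwards [ae_essInf_le hbd] with y hy
  rw [zeroIntegrand]
  gcongr

theorem phiWellDefined (hb : 0 < b) (hθm : Measurable θ)
    (hθ : ∀ s : ℝ, 0 ≤ s → 1 - s / b ≤ θ s ∧ θ s ≤ 1 + s / b) {lam : ℝ} (hl : 0 ≤ lam)
    {ξ : L2R3} (hξ : ξ ∈ HHalf) : PhiWellDefined γ 𝔞 θ lam ξ :=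
  ⟨integrable_diagIntegrand hξ hl, integrable_offIntegrand hξ hl, integrable_regIntegrand hξ,
    integrable_zeroIntegrand hb hθm hθ ξ⟩

theorem phi_re (lam : ℝ) (ξ : L2R3) : (Phi γ 𝔞 θ lam ξ).re =
    12 * Real.pi * (∫ p, diagIntegrand lam ξ p) - 12 / Real.pi * (∫ z, offIntegrand lam ξ z).re
      + 6 * γ / Real.pi * (∫ z, regIntegrand ξ z).re
      + 12 * Real.pi * ∫ y, zeroIntegrand γ 𝔞 θ ξ y := by
  simp only [Phi, PhiDiag, PhiOff, PhiReg, PhiZero, Complex.add_re, Complex.ofReal_re, neg_mul,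
    Complex.neg_re, Complex.re_ofReal_mul]
  ring

theorem phi_im (lam : ℝ) (ξ : L2R3) : (Phi γ 𝔞 θ lam ξ).im = 0 := by
  simp only [Phi, PhiOff, PhiReg, Complex.add_im, Complex.ofReal_im, neg_mul,
    Complex.neg_im, Complex.im_ofReal_mul, im_integral_off, im_integral_reg]
  ring

theorem norm_phi_le (hb : 0 < b)
    (hθ : ∀ s : ℝ, 0 ≤ s → 1 - s / b ≤ θ s ∧ θ s ≤ 1 + s / b) {lam : ℝ} (hl : 0 ≤ lam)
    {ξ : L2R3} (hξ : ξ ∈ HHalf) : ‖Phi γ 𝔞 θ lam ξ‖ ≤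
      12 * Real.pi * (kinetic ξ + √lam * ‖ξ‖ ^ 2)
      + 12 / Real.pi * (4 * (Real.pi ^ 3 * kinetic ξ))
      + |6 * γ / Real.pi| * (Real.pi ^ 3 * kinetic ξ)
      + 12 * Real.pi * ((|1 / 𝔞| + |γ| / b) * ‖ξ‖ ^ 2) := by
  have hpi := Real.pi_pos
  refine (norm_add_le _ _).trans (add_le_add ((norm_add_le _ _).trans
    (add_le_add ((norm_add_le _ _).trans (add_le_add ?_ ?_)) ?_)) ?_)
  · have h0 : 0 ≤ ∫ p, diagIntegrand lam ξ p :=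
      integral_nonneg fun p => by unfold diagIntegrand; positivity
    rw [PhiDiag, Complex.norm_real, Real.norm_of_nonneg (by positivity)]
    gcongr
    exact integral_diag_le hξ hl
  · rw [PhiOff, norm_mul, norm_neg, Complex.norm_real, Real.norm_of_nonneg (by positivity)]
    gcongr
    exact (norm_integral_le_integral_norm _).trans (integral_norm_off_le hξ hl)
  · rw [PhiReg, norm_mul, Complex.norm_real, Real.norm_eq_abs]
    gcongr
    exact (norm_integral_le_integral_norm _).trans (integral_norm_reg_le hξ)
  · rw [PhiZero, Complex.norm_real, norm_mul,
      Real.norm_of_nonneg (by positivity : 0 ≤ 12 * Real.pi),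
      Real.norm_eq_abs]
    gcongr
    exact abs_integral_zero_le hb hθ ξ

/-- Replace off by the larger reg; the non-local terms become -(6/π)(2-γ) reg. Since reg ≥ 0, only
the positive part of 2-γ can hurt, and there reg ≤ π³ K applies. -/
theorem le_phi_re (hb : 0 < b) (hθm : Measurable θ)
    (hθ : ∀ s : ℝ, 0 ≤ s → 1 - s / b ≤ θ s ∧ θ s ≤ 1 + s / b) {lam : ℝ} (hl : 0 ≤ lam)
    {ξ : L2R3} (hξ : ξ ∈ HHalf) :
    12 * Real.pi * (∫ p, diagIntegrand lam ξ p) - 6 * Real.pi ^ 2 * max 0 (2 - γ) * kinetic ξ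
      + 12 * Real.pi * (essInf (beta γ 𝔞 θ) volume * ‖ξ‖ ^ 2) ≤ (Phi γ 𝔞 θ lam ξ).re := by
  have hpi := Real.pi_pos
  rw [phi_re]
  have h1 := re_off_le_re_reg hξ hl
  have h2 := re_reg_nonneg hξ
  have h3 := re_reg_le hξ
  have h4 := essInf_beta_mul_le (γ := γ) (𝔞 := 𝔞) hb hθm hθ ξ
  set off := (∫ z, offIntegrand lam ξ z).re
  set reg := (∫ z, regIntegrand ξ z).re
  have h5 : 12 * Real.pi * (essInf (beta γ 𝔞 θ) volume * ‖ξ‖ ^ 2)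
      ≤ 12 * Real.pi * ∫ y, zeroIntegrand γ 𝔞 θ ξ y := by gcongr
  have h6 : 12 / Real.pi * off ≤ 12 / Real.pi * reg := by gcongr
  have h7 : 6 / Real.pi * ((2 - γ) * reg) ≤ 6 * Real.pi ^ 2 * max 0 (2 - γ) * kinetic ξ := by
    calc 6 / Real.pi * ((2 - γ) * reg)
        ≤ 6 / Real.pi * (max 0 (2 - γ) * (Real.pi ^ 3 * kinetic ξ)) := by
          gcongr
          exact le_max_right _ _
      _ = _ := by field_simp
  have h8 : 6 * γ / Real.pi * reg = 12 / Real.pi * reg - 6 / Real.pi * ((2 - γ) * reg) := by ring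
  linarith

end Potential

/-! ### The symbol and the constant c(λ) -/

theorem gap_pos {γ : ℝ} (hγ : gammaC' < γ) : 0 < gap γ := by
  have hpi := Real.pi_pos
  have h1 : max 0 (2 - γ) < √3 / Real.pi := by
    unfold gammaC' at hγ
    exact max_lt (by positivity) (by linarith)
  have h2 : Real.pi * max 0 (2 - γ) < √3 := by rwa [lt_div_iff₀' hpi] at h1
  have h3 : (Real.pi * max 0 (2 - γ)) ^ 2 < √3 ^ 2 :=
    pow_lt_pow_left₀ h2 (mul_nonneg hpi.le (le_max_left _ _)) two_ne_zero
  rw [Real.sq_sqrt (by norm_num), mul_pow] at h3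
  unfold gap
  linarith

theorem pi_mul_max_lt {γ : ℝ} (hγ : 0 < gap γ) : Real.pi * max 0 (2 - γ) < √3 := by
  refine Real.lt_sqrt_of_sq_lt ?_
  unfold gap at hγ
  rw [mul_pow]
  linarith

/-- With u = π max{0,2-γ} and g = √(gap γ) one has u² + g² = 3, so this is Cauchy–Schwarz for (g, u)
and (√3√λ, 3r/2). The defect is the square (√3√λ u - 3rg/2)², which vanishes for a suitable r, so
the constant is optimal. -/
theorem symbol_lower_bound {γ lam r : ℝ} (hγ : 0 < gap γ) (hl : 0 ≤ lam) :
    4 * √3 * Real.pi * √lam * √(gap γ)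
      ≤ 12 * Real.pi * √(3 / 4 * r ^ 2 + lam) - 6 * Real.pi ^ 2 * max 0 (2 - γ) * r := by
  have hpi := Real.pi_pos
  set u := Real.pi * max 0 (2 - γ) with hu
  have hug : u ^ 2 + √(gap γ) ^ 2 = 3 := by
    rw [Real.sq_sqrt hγ.le, gap, hu]; ring
  have h3 : √3 ^ 2 = 3 := Real.sq_sqrt (by norm_num)
  have hl2 : √lam ^ 2 = lam := Real.sq_sqrt hl
  have h1 : √3 * √lam * √(gap γ) + 3 / 2 * u * r ≤ 3 * √(3 / 4 * r ^ 2 + lam) := by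
    have e3 : 3 * √(3 / 4 * r ^ 2 + lam) = √(3 ^ 2 * (3 / 4 * r ^ 2 + lam)) := by
      rw [Real.sqrt_mul (by norm_num), Real.sqrt_sq (by norm_num)]
    rw [e3]
    refine Real.le_sqrt_of_sq_le ?_
    set s := √3
    set L := √lam
    set g := √(gap γ)
    rw [← hl2]
    have e : 3 ^ 2 * (3 / 4 * r ^ 2 + L ^ 2) - (s * L * g + 3 / 2 * u * r) ^ 2
        = (s * L * u - 3 / 2 * r * g) ^ 2 := by
      have : (s * L * g + 3 / 2 * u * r) ^ 2 + (s * L * u - 3 / 2 * r * g) ^ 2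
          = (u ^ 2 + g ^ 2) * (s ^ 2 * L ^ 2 + 9 / 4 * r ^ 2) := by ring
      rw [hug, h3] at this
      linarith
    linarith [sq_nonneg (s * L * u - 3 / 2 * r * g)]
  calc 4 * √3 * Real.pi * √lam * √(gap γ)
      = 4 * Real.pi * (√3 * √lam * √(gap γ) + 3 / 2 * u * r) - 6 * Real.pi * u * r := by ring
    _ ≤ 4 * Real.pi * (3 * √(3 / 4 * r ^ 2 + lam)) - 6 * Real.pi * u * r := by gcongr
    _ = _ := by rw [hu]; ring

/-- Dropping λ under the root leaves (√3/2) r. The coefficient is positive exactly when `gap γ` is,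
which makes Φ control the kinetic energy. -/
theorem symbol_kinetic_bound {γ lam r : ℝ} (hl : 0 ≤ lam) :
    6 * Real.pi * (√3 - Real.pi * max 0 (2 - γ)) * r
      ≤ 12 * Real.pi * √(3 / 4 * r ^ 2 + lam) - 6 * Real.pi ^ 2 * max 0 (2 - γ) * r := by
  have hpi := Real.pi_pos
  have h1 : √3 / 2 * r ≤ √(3 / 4 * r ^ 2 + lam) := by
    refine Real.le_sqrt_of_sq_le ?_
    rw [mul_pow, div_pow, Real.sq_sqrt (by norm_num)]
    linarith
  calc _ = 12 * Real.pi * (√3 / 2 * r) - 6 * Real.pi ^ 2 * max 0 (2 - γ) * r := by ring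
    _ ≤ _ := by gcongr

theorem integral_diag_lower {γ lam : ℝ} (hγ : 0 < gap γ) (hl : 0 ≤ lam) {ξ : L2R3}
    (hξ : ξ ∈ HHalf) : 4 * √3 * Real.pi * √lam * √(gap γ) * ‖ξ‖ ^ 2
      ≤ 12 * Real.pi * (∫ p, diagIntegrand lam ξ p)
        - 6 * Real.pi ^ 2 * max 0 (2 - γ) * kinetic ξ := by
  have hd := (integrable_diagIntegrand hξ hl).const_mul (12 * Real.pi)
  have hk := (integrable_kinetic hξ).const_mul (6 * Real.pi ^ 2 * max 0 (2 - γ))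
  rw [← integral_norm_hat_sq, ← integral_const_mul, ← integral_const_mul, kinetic,
    ← integral_const_mul, ← integral_sub hd hk]
  refine integral_mono ((integrable_norm_hat_sq ξ).const_mul _) (hd.sub hk) fun p => ?_
  have h := mul_le_mul_of_nonneg_right (symbol_lower_bound (r := ‖p‖) hγ hl)
    (sq_nonneg ‖hat ξ p‖)
  simp only [diagIntegrand]
  linarith

theorem integral_diag_kinetic {γ lam : ℝ} (hl : 0 ≤ lam) {ξ : L2R3}
    (hξ : ξ ∈ HHalf) : 6 * Real.pi * (√3 - Real.pi * max 0 (2 - γ)) * kinetic ξ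
      ≤ 12 * Real.pi * (∫ p, diagIntegrand lam ξ p)
        - 6 * Real.pi ^ 2 * max 0 (2 - γ) * kinetic ξ := by
  have hd := (integrable_diagIntegrand hξ hl).const_mul (12 * Real.pi)
  have hk := (integrable_kinetic hξ).const_mul (6 * Real.pi ^ 2 * max 0 (2 - γ))
  have hk' := (integrable_kinetic hξ).const_mul (6 * Real.pi * (√3 - Real.pi * max 0 (2 - γ)))
  rw [kinetic, ← integral_const_mul, ← integral_const_mul, ← integral_const_mul,
    ← integral_sub hd hk]
  refine integral_mono hk' (hd.sub hk) fun p => ?_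
  have h := mul_le_mul_of_nonneg_right (symbol_kinetic_bound (γ := γ) (r := ‖p‖) hl)
    (sq_nonneg ‖hat ξ p‖)
  simp only [diagIntegrand]
  linarith

/-- The hypothesis says λ · gap > 3 min{0, ess inf β}². Taking roots and multiplying by 4√3π gives
exactly -12π min{0, ess inf β} on the right. -/
theorem coercivityConst_pos {γ 𝔞 lam : ℝ} {θ : ℝ → ℝ} (hγ : 0 < gap γ)
    (h : 3 * (min 0 (essInf (beta γ 𝔞 θ) volume)) ^ 2 / gap γ < lam) :
    0 < coercivityConst γ 𝔞 θ lam := by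
  have hpi := Real.pi_pos
  unfold coercivityConst
  set β := essInf (beta γ 𝔞 θ) volume
  have h3 : (0 : ℝ) < √3 := by positivity
  have h1 : √3 * -min 0 β < √lam * √(gap γ) := by
    have hl : 0 ≤ lam := le_trans (by positivity) h.le
    rw [← Real.sqrt_mul hl]
    refine Real.lt_sqrt_of_sq_lt ?_
    rw [div_lt_iff₀ hγ] at h
    rwa [mul_pow, neg_sq, Real.sq_sqrt (by norm_num)]
  have h2 : √3 * (√3 * -min 0 β) < √3 * (√lam * √(gap γ)) := by gcongr
  rw [← mul_assoc, Real.mul_self_sqrt (by norm_num)] at h2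
  have h4 : 12 * Real.pi * min 0 β ≤ 12 * Real.pi * β := by
    gcongr
    exact min_le_right _ _
  have h5 : 4 * Real.pi * (3 * -min 0 β) < 4 * Real.pi * (√3 * (√lam * √(gap γ))) := by gcongr
  linarith

/-! ### Closedness -/

theorem exists_subseq_tendsto_hat {u : ℕ → L2R3} {ξ : L2R3} (hu : Tendsto u atTop (𝓝 ξ)) :
    ∃ φ : ℕ → ℕ, StrictMono φ ∧
      ∀ᵐ p, Tendsto (fun k => hat (u (φ k)) p) atTop (𝓝 (hat ξ p)) := by
  refine TendstoInMeasure.exists_seq_tendsto_ae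
    (tendstoInMeasure_of_tendsto_eLpNorm (p := 2) two_ne_zero
      (fun n => aestronglyMeasurable_hat (u n)) (aestronglyMeasurable_hat ξ) ?_)
  have h1 : ∀ n, eLpNorm (hat (u n) - hat ξ) 2 volume = ‖u n - ξ‖ₑ := by
    intro n
    have h2 : hat (u n) - hat ξ =ᵐ[volume] hat (u n - ξ) := (hat_sub_ae _ _).symm
    rw [eLpNorm_congr_ae h2]
    have h3 := lintegral_enorm_hat_sq (u n - ξ)
    rw [← eLpNorm_two_sq] at h3
    exact (ENNReal.pow_right_strictMono two_ne_zero).injective h3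
  simp only [h1]
  rw [← tendsto_sub_nhds_zero_iff] at hu
  simpa using hu.enorm

/-- Fatou's lemma for the kinetic energy. -/
theorem lintegral_kinetic_le_of_tendsto {u : ℕ → L2R3} {ξ v : L2R3} {C : ℝ≥0∞} {N : ℕ}
    (hu : Tendsto u atTop (𝓝 ξ))
    (hC : ∀ m, N ≤ m → ∫⁻ p, ‖p‖ₑ * ‖hat (v - u m) p‖ₑ ^ 2 ≤ C) :
    ∫⁻ p, ‖p‖ₑ * ‖hat (v - ξ) p‖ₑ ^ 2 ≤ C := by
  obtain ⟨φ, hφ, hlim⟩ := exists_subseq_tendsto_hat hu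
  have h1 : ∀ᵐ p, ∀ k, hat (v - u (φ k)) p = hat v p - hat (u (φ k)) p :=
    ae_all_iff.mpr fun k => hat_sub_ae _ _
  have h2 : ∀ᵐ p, ‖p‖ₑ * ‖hat (v - ξ) p‖ₑ ^ 2
      = liminf (fun k => ‖p‖ₑ * ‖hat (v - u (φ k)) p‖ₑ ^ 2) atTop := by
    filter_upwards [hlim, h1, hat_sub_ae v ξ] with p hp1 hp2 hp3
    refine (Tendsto.liminf_eq ?_).symm
    simp only [hp2, hp3]
    exact ENNReal.Tendsto.const_mul (ENNReal.Tendsto.pow (tendsto_const_nhds.sub hp1).enorm)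
      (Or.inr enorm_ne_top)
  rw [lintegral_congr_ae h2]
  refine (lintegral_liminf_le' fun k => ?_).trans ?_
  · exact continuous_enorm.measurable.aemeasurable.mul
      ((aestronglyMeasurable_hat _).enorm.pow_const 2)
  · refine liminf_le_of_frequently_le' (Eventually.frequently ?_)
    filter_upwards [eventually_ge_atTop N] with k hk
    exact hC _ (hk.trans (hφ.id_le k))

theorem isClosedForm_phi {γ 𝔞 b lam : ℝ} {θ : ℝ → ℝ} (hb : 0 < b) (hθm : Measurable θ)
    (hθ : ∀ s : ℝ, 0 ≤ s → 1 - s / b ≤ θ s ∧ θ s ≤ 1 + s / b) (hγ : 0 < gap γ) (hl : 0 ≤ lam) :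
    IsClosedForm HHalf (Phi γ 𝔞 θ lam) := by
  intro u ξ hu hlim hΦ
  have hpi := Real.pi_pos
  set κ := 6 * Real.pi * (√3 - Real.pi * max 0 (2 - γ)) with hκ
  have hκ0 : 0 < κ := mul_pos (by positivity) (sub_pos.mpr (pi_mul_max_lt hγ))
  set β := essInf (beta γ 𝔞 θ) volume
  -- The β term may have either sign, but it is a multiple of ‖v‖² and vanishes along L²-convergent
  -- differences. Positivity of c(λ) is therefore not needed for closedness.
  have hbound : ∀ v ∈ HHalf, kinetic v
      ≤ κ⁻¹ * ((Phi γ 𝔞 θ lam v).re - 12 * Real.pi * (β * ‖v‖ ^ 2)) := by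
    intro v hv
    have h1 := le_phi_re (γ := γ) (𝔞 := 𝔞) hb hθm hθ hl hv
    have h2 := integral_diag_kinetic (γ := γ) hl hv
    rw [inv_mul_eq_div, le_div_iff₀' hκ0]
    linarith
  have hd : Tendsto (fun k : ℕ × ℕ => u k.1 - u k.2) atTop (𝓝 0) := by
    rw [← prod_atTop_atTop_eq]
    simpa using (hlim.comp tendsto_fst).sub (hlim.comp tendsto_snd)
  have hE : Tendsto (fun k : ℕ × ℕ => kinetic (u k.1 - u k.2)) atTop (𝓝 0) := by
    refine squeeze_zero (fun k => kinetic_nonneg _)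
      (fun k => hbound _ (HHalf_sub (hu k.1) (hu k.2))) ?_
    have h1 := ((Complex.continuous_re.tendsto _).comp hΦ).sub
      (((hd.norm.pow 2).const_mul β).const_mul (12 * Real.pi))
    simpa using h1.const_mul κ⁻¹
  -- Fix n and let m → ∞ in the kinetic Cauchy condition; Fatou's lemma passes the bound to `u n -
  -- ξ` before ξ is known to lie in H^{1/2}.
  have hfat : ∀ ε > 0, ∃ N, ∀ n, N ≤ n →
      ∫⁻ p, ‖p‖ₑ * ‖hat (u n - ξ) p‖ₑ ^ 2 ≤ ENNReal.ofReal ε := by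
    intro ε hε
    obtain ⟨N, hN⟩ := eventually_atTop.mp (hE.eventually (gt_mem_nhds hε))
    refine ⟨max N.1 N.2, fun n hn => lintegral_kinetic_le_of_tendsto (N := N.2) hlim ?_⟩
    intro m hm
    rw [← ofReal_kinetic (HHalf_sub (hu n) (hu m))]
    exact ENNReal.ofReal_le_ofReal (hN (n, m) ⟨(le_max_left _ _).trans hn, hm⟩).le
  have hξ : ξ ∈ HHalf := by
    obtain ⟨N, hN⟩ := hfat 1 one_pos
    have h1 : u N - ξ ∈ HHalf :=
      (mem_HHalf_iff _).mpr ((hN N le_rfl).trans_lt ENNReal.ofReal_lt_top)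
    -- ξ = u_N - (u_N - ξ).
    simpa using HHalf_sub (hu N) h1
  have hsub : ∀ n, u n - ξ ∈ HHalf := fun n => HHalf_sub (hu n) hξ
  have hK : Tendsto (fun n => kinetic (u n - ξ)) atTop (𝓝 0) := by
    rw [Metric.tendsto_atTop]
    intro ε hε
    obtain ⟨N, hN⟩ := hfat (ε / 2) (by positivity)
    refine ⟨N, fun n hn => ?_⟩
    have h1 := hN n hn
    rw [← ofReal_kinetic (hsub n), ENNReal.ofReal_le_ofReal_iff (by positivity)] at h1
    rw [Real.dist_0_eq_abs, abs_of_nonneg (kinetic_nonneg _)]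
    linarith
  have hn : Tendsto (fun n => ‖u n - ξ‖ ^ 2) atTop (𝓝 0) := by
    rw [← tendsto_sub_nhds_zero_iff] at hlim
    simpa using hlim.norm.pow 2
  refine ⟨hξ, squeeze_zero_norm (fun n => norm_phi_le (γ := γ) (𝔞 := 𝔞) hb hθ hl (hsub n)) ?_⟩
  have h1 := ((((hK.add (hn.const_mul √lam)).const_mul (12 * Real.pi)).add
    (((hK.const_mul (Real.pi ^ 3)).const_mul 4).const_mul (12 / Real.pi))).add
    ((hK.const_mul (Real.pi ^ 3)).const_mul |6 * γ / Real.pi|)).add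
    ((hn.const_mul (|1 / 𝔞| + |γ| / b)).const_mul (12 * Real.pi))
  simpa using h1

end ThreeBoson

end

theorem mainTheorem5 (γ 𝔞 b : ℝ) (θ : ℝ → ℝ)
    (h𝔞 : 𝔞 ≠ 0) (hb : 0 < b)
    (hθ_meas : Measurable θ) (hθ_supp : HasCompactSupport θ)
    (hθ : ∀ s : ℝ, 0 ≤ s → 1 - s / b ≤ θ s ∧ θ s ≤ 1 + s / b)
    (hγ : ThreeBoson.gammaC' < γ) :
    0 < ThreeBoson.gap γ ∧
    (∀ lam : ℝ, 0 < lam → ∀ ξ ∈ ThreeBoson.HHalf,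
      ThreeBoson.PhiWellDefined γ 𝔞 θ lam ξ ∧
      (ThreeBoson.Phi γ 𝔞 θ lam ξ).im = 0 ∧
      ThreeBoson.coercivityConst γ 𝔞 θ lam * ‖ξ‖ ^ 2 ≤ (ThreeBoson.Phi γ 𝔞 θ lam ξ).re) ∧
    (∀ lam : ℝ,
      3 * (min 0 (essInf (ThreeBoson.beta γ 𝔞 θ) volume)) ^ 2 / ThreeBoson.gap γ < lam →
      0 < ThreeBoson.coercivityConst γ 𝔞 θ lam ∧
      ThreeBoson.IsClosedForm ThreeBoson.HHalf (ThreeBoson.Phi γ 𝔞 θ lam)) := by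
  have hgap := ThreeBoson.gap_pos hγ
  refine ⟨hgap, fun lam hl ξ hξ => ⟨ThreeBoson.phiWellDefined hb hθ_meas hθ hl.le hξ,
    ThreeBoson.phi_im lam ξ, ?_⟩, fun lam hlam =>
    ⟨ThreeBoson.coercivityConst_pos hgap hlam, ThreeBoson.isClosedForm_phi hb hθ_meas hθ hgap
      (le_trans (by positivity) hlam.le)⟩⟩
  have h1 := ThreeBoson.le_phi_re (γ := γ) (𝔞 := 𝔞) hb hθ_meas hθ hl.le hξ
  have h2 := ThreeBoson.integral_diag_lower hgap hl.le hξ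
  rw [ThreeBoson.coercivityConst, add_mul]
  linarith
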